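/- Let $k$ be an algebraically closed field of characteristic $0$. Let $(q_{ij})_{0\le i,j\le 3}$ and $(q'_{ij})_{0\le i,j\le 2}$ be elements of $k^\times$ with $q_{ii}=q_{ij}q_{ji}=q_{ij}^4=1$ and $q'_{ii}=q'_{ij}q'_{ji}=(q'_{ij})^3=1$, and put $$A=k\langle x_0,\dots,x_3\rangle/(x_jx_i-q_{ji}x_ix_j)_{i,j},\qquad B=k\langle y_0,y_1,y_2\rangle/(y_jy_i-q'_{ji}y_iy_j)_{i,j},$$ $f=\sum_{i=0}^3x_i^4\in A$, $g=\sum_{i=0}^2y_i^3\in B$. Let $J=(f,g)$ be the two-sided ideal of the $\mathbb N^2$-graded algebra $A\otimes_kB$ generated by $f\otimes1$ and $1\otimes g$, let $A\circ B=\bigoplus_{i\ge0}A_i\otimes_kB_i$ be the Segre product, with its $\mathbb N$-grading, and let $J_\Delta=\bigoplus_{i\ge0}J_{(i,i)}$. Assume the Calabi–Yau condition: neither $\prod_{i=0}^3q_{ij}$ nor $\prod_{i=0}^2q'_{ij}$ depends on $j$. Assume that $\{q_{ij}\}$ is general, i.e. $q_{ij}q_{jl}q_{li}\ne1$ for some $i,j,l$.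 A point module of a connected graded $k$-algebra $C=\bigoplus_dC_d$ (graded by $\mathbb N$ or $\mathbb N^2$) is a graded right $C$-module $M=\bigoplus_d M_d$ that is cyclic, generated in degree $0$, with $\dim_kM_d=1$ for all $d$. The moduli space $\mathcal M_C$ is the set of isomorphism classes of point modules with the Zariski topology, i.e. the topology induced by the embedding into $\prod_d\mathbb P(C_d^*)$ that sends $M=m_0C$ to the classes of the linear forms $C_d\to M_d\cong k$, $a\mapsto m_0a$. Then $\dim\mathcal M_{A\otimes_kB/J}=1$ and $\dim\mathcal M_{A\circ B/J_\Delta}=1$, where $\dim$ is the Krull dimension of the topological space. -/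

import Mathlib

open scoped TensorProduct

noncomputable section

/-! ### Point modules of a graded algebra and their moduli space

Everything is written for an algebra graded by an additive monoid `ι`; it is used for `ι = ℕ` and
`ι = ℕ × ℕ`. A right module is a module over the opposite ring. -/

section PointModules

universe u v w

variable {k : Type u} [Field k] {C : Type v} [Ring C] [Algebra k C]
  {ι : Type w} [AddMonoid ι] [DecidableEq ι]

/-- A point module of the graded `k`-algebra `C = ⨁ 𝒞 d`: a graded right `C`-module which is
cyclic, generated in degree `0`, and has `dim M_d = 1` for all `d`. -/
structure PointModule (𝒞 : ι → Submodule k C) where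
  carrier : Type v
  [addCommGroup : AddCommGroup carrier]
  [module : Module k carrier]
  [rightModule : Module Cᵐᵒᵖ carrier]
  [isScalarTower : IsScalarTower k Cᵐᵒᵖ carrier]
  /-- the homogeneous components -/
  comp : ι → Submodule k carrier
  isInternal : DirectSum.IsInternal comp
  smul_mem : ∀ ⦃d e : ι⦄ ⦃m : carrier⦄ ⦃a : C⦄, m ∈ comp d → a ∈ 𝒞 e →
    MulOpposite.op a • m ∈ comp (d + e)
  cyclic : ∃ m ∈ comp 0, Submodule.span Cᵐᵒᵖ {m} = ⊤
  finrank_comp : ∀ d, Module.finrank k (comp d) = 1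

attribute [instance] PointModule.addCommGroup PointModule.module PointModule.rightModule
  PointModule.isScalarTower

variable {𝒞 : ι → Submodule k C}

/-- Two point modules are isomorphic if there is a degree-preserving isomorphism of right
`C`-modules between them. -/
def PointModule.Iso (M N : PointModule 𝒞) : Prop :=
  ∃ e : M.carrier ≃ₗ[Cᵐᵒᵖ] N.carrier, ∀ d, ∀ m : M.carrier, m ∈ M.comp d ↔ e m ∈ N.comp d

theorem PointModule.iso_equivalence :
    Equivalence (PointModule.Iso : PointModule 𝒞 → PointModule 𝒞 → Prop) where
  refl M := ⟨LinearEquiv.refl _ _, fun _ _ => Iff.rfl⟩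
  symm := by
    rintro M N ⟨e, he⟩
    exact ⟨e.symm, fun d n => by rw [he d (e.symm n), e.apply_symm_apply]⟩
  trans := by
    rintro M N P ⟨e, he⟩ ⟨e', he'⟩
    exact ⟨e.trans e', fun d m => (he d m).trans (he' d (e m))⟩

variable (𝒞) in
/-- Isomorphism of point modules as a setoid. -/
def PointModule.setoid : Setoid (PointModule 𝒞) where
  r := PointModule.Iso
  iseqv := PointModule.iso_equivalence

variable (𝒞) in
/-- The points of the moduli space of point modules: isomorphism classes of point modules. -/
def PointModuli : Type _ := Quotient (PointModule.setoid 𝒞)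

/-- `φ` is a system of multihomogeneous coordinates of the point module `M`: for some choice of
basis vectors `m d` of the lines `M_d` one has `m 0 · a = φ_d(a) m d` for all `a` in `𝒞 d`. Thus
`φ_d` is the linear form `C_d → M_d ≅ k`, i.e. the point of the projective space of
one-dimensional quotients of `C_d` given by `M`; another choice of the `m d` rescales each `φ_d`
by a nonzero scalar. -/
def PointModule.IsCoord (M : PointModule 𝒞) (φ : (Σ d, 𝒞 d) → k) : Prop :=
  ∃ m : ι → M.carrier, (∀ d, m d ∈ M.comp d ∧ m d ≠ 0) ∧
    ∀ d (a : 𝒞 d), MulOpposite.op (a : C) • m 0 = φ ⟨d, a⟩ • m d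

/-- A polynomial in the coordinates `φ_d(a)` is multihomogeneous if for every `d` it is
homogeneous in the coordinates `φ_d(a)`, `a ∈ 𝒞 d`, of some degree `n d`. -/
def IsMultihomogeneous (p : MvPolynomial (Σ d, 𝒞 d) k) : Prop :=
  ∃ n : ι →₀ ℕ, MvPolynomial.IsWeightedHomogeneous
    (fun s : (Σ d, 𝒞 d) => Finsupp.single s.1 1) p n

variable (𝒞) in
/-- The locus in the moduli space where the multihomogeneous polynomial `p` does not vanish. -/
def PointModuli.basicOpen (p : MvPolynomial (Σ d, 𝒞 d) k) : Set (PointModuli 𝒞) :=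
  {z | ∃ (M : PointModule 𝒞) (φ : (Σ d, 𝒞 d) → k),
    Quotient.mk (PointModule.setoid 𝒞) M = z ∧ M.IsCoord φ ∧ MvPolynomial.eval φ p ≠ 0}

/-- The Zariski topology of the moduli space, i.e. the one induced from the product over all `d` of
the projective spaces of one-dimensional quotients of `C_d`. -/
instance PointModuli.zariskiTopology : TopologicalSpace (PointModuli 𝒞) :=
  TopologicalSpace.generateFrom
    {U | ∃ p : MvPolynomial (Σ d, 𝒞 d) k, IsMultihomogeneous p ∧ U = PointModuli.basicOpen 𝒞 p}

end PointModules

/-! ### Quantum polynomial rings, the algebra `A ⊗ B / J` and the Segre product `A ∘ B / J_Δ` -/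

section Algebras

universe u

variable {k : Type u} [Field k] {n m : ℕ}

/-- The relations `x_j x_i = q_{ji} x_i x_j`. -/
inductive QuantumRel (q : Fin n → Fin n → k) :
    FreeAlgebra k (Fin n) → FreeAlgebra k (Fin n) → Prop
  | comm (i j : Fin n) : QuantumRel q (FreeAlgebra.ι k j * FreeAlgebra.ι k i)
      (q j i • (FreeAlgebra.ι k i * FreeAlgebra.ι k j))

/-- The quantum polynomial ring `k⟨x_0, …, x_{n-1}⟩ / (x_j x_i - q_{ji} x_i x_j)`. -/
def QuantumPoly (q : Fin n → Fin n → k) : Type u := RingQuot (QuantumRel q)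

instance (q : Fin n → Fin n → k) : Ring (QuantumPoly q) :=
  inferInstanceAs (Ring (RingQuot (QuantumRel q)))

instance (q : Fin n → Fin n → k) : Algebra k (QuantumPoly q) :=
  inferInstanceAs (Algebra k (RingQuot (QuantumRel q)))

/-- The generator `x_i`. -/
def QuantumPoly.x (q : Fin n → Fin n → k) (i : Fin n) : QuantumPoly q :=
  RingQuot.mkAlgHom k (QuantumRel q) (FreeAlgebra.ι k i)

/-- The component of degree `d`, spanned by the products of `d` generators. -/
def QuantumPoly.deg (q : Fin n → Fin n → k) (d : ℕ) : Submodule k (QuantumPoly q) :=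
  Submodule.span k (Set.range (QuantumPoly.x q)) ^ d

/-- The Fermat element `∑ x_i ^ n` in the quantum polynomial ring in `n` variables. -/
def QuantumPoly.fermat (q : Fin n → Fin n → k) : QuantumPoly q :=
  ∑ i, QuantumPoly.x q i ^ n

instance (q : Fin n → Fin n → k) : SetLike.GradedMonoid (QuantumPoly.deg q) :=
  Submodule.nat_power_gradedMonoid _

section Tensor

variable {A B : Type u} [Ring A] [Algebra k A] [Ring B] [Algebra k B]
  (𝒜 : ℕ → Submodule k A) (ℬ : ℕ → Submodule k B)

/-- The component `A_i ⊗ B_j` of degree `(i, j)` of the bigraded algebra `A ⊗ B`. -/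
def tensorDeg (d : ℕ × ℕ) : Submodule k (A ⊗[k] B) :=
  LinearMap.range (TensorProduct.map (𝒜 d.1).subtype (ℬ d.2).subtype)

/-- The component of degree `d` of the quotient of `A ⊗ B` by a (bihomogeneous) two-sided ideal:
the image of `(A ⊗ B)_d`. -/
def tensorQuotDeg (J : TwoSidedIdeal (A ⊗[k] B)) (d : ℕ × ℕ) :
    Submodule k J.ringCon.Quotient :=
  (tensorDeg 𝒜 ℬ d).map (J.ringCon.mkₐ k).toLinearMap

variable [SetLike.GradedMonoid 𝒜] [SetLike.GradedMonoid ℬ]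

theorem one_mem_tensorDeg : (1 : A ⊗[k] B) ∈ tensorDeg 𝒜 ℬ (0, 0) :=
  ⟨⟨1, SetLike.GradedOne.one_mem⟩ ⊗ₜ ⟨1, SetLike.GradedOne.one_mem⟩, rfl⟩

theorem mul_mem_tensorDeg {d e : ℕ × ℕ} {a b : A ⊗[k] B}
    (ha : a ∈ tensorDeg 𝒜 ℬ d) (hb : b ∈ tensorDeg 𝒜 ℬ e) :
    a * b ∈ tensorDeg 𝒜 ℬ (d + e) := by
  obtain ⟨s, rfl⟩ := ha
  obtain ⟨t, rfl⟩ := hb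
  induction s with
  | zero => simp
  | add s₁ s₂ h₁ h₂ => rw [map_add, add_mul]; exact add_mem h₁ h₂
  | tmul a₁ a₂ =>
    induction t with
    | zero => simp
    | add t₁ t₂ h₁ h₂ => rw [map_add, mul_add]; exact add_mem h₁ h₂
    | tmul b₁ b₂ =>
      exact ⟨⟨a₁ * b₁, SetLike.GradedMul.mul_mem a₁.2 b₁.2⟩ ⊗ₜ
        ⟨a₂ * b₂, SetLike.GradedMul.mul_mem a₂.2 b₂.2⟩, by simp⟩

/-- The Segre product `A ∘ B = ⨁ A_i ⊗ B_i`, as a subalgebra of `A ⊗ B`. -/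
def segreProduct : Subalgebra k (A ⊗[k] B) :=
  (⨆ i : ℕ, tensorDeg 𝒜 ℬ (i, i)).toSubalgebra
    (Submodule.mem_iSup_of_mem (p := fun i : ℕ => tensorDeg 𝒜 ℬ (i, i)) 0
      (one_mem_tensorDeg 𝒜 ℬ)) (by
      intro a b ha hb
      induction ha using Submodule.iSup_induction' with
      | zero => simp
      | add a₁ a₂ _ _ h₁ h₂ => rw [add_mul]; exact add_mem h₁ h₂
      | mem i a ha =>
        induction hb using Submodule.iSup_induction' with
        | zero => simp
        | add b₁ b₂ _ _ h₁ h₂ => rw [mul_add]; exact add_mem h₁ h₂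
        | mem j b hb =>
          have h := mul_mem_tensorDeg 𝒜 ℬ ha hb
          rw [Prod.mk_add_mk] at h
          exact Submodule.mem_iSup_of_mem (p := fun i : ℕ => tensorDeg 𝒜 ℬ (i, i)) (i + j) h)

/-- The ideal `J_Δ = ⨁ J_{(i,i)}` of `A ∘ B`; for a bihomogeneous ideal `J` of `A ⊗ B` it is
`J ∩ (A ∘ B)`. -/
def diagIdeal (J : TwoSidedIdeal (A ⊗[k] B)) : TwoSidedIdeal (segreProduct 𝒜 ℬ) :=
  J.comap (segreProduct 𝒜 ℬ).val

/-- The component of degree `i` of `A ∘ B / J_Δ`: the image of `A_i ⊗ B_i`. -/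
def segreQuotDeg (J : TwoSidedIdeal (A ⊗[k] B)) (i : ℕ) :
    Submodule k (diagIdeal 𝒜 ℬ J).ringCon.Quotient :=
  ((tensorDeg 𝒜 ℬ (i, i)).comap (segreProduct 𝒜 ℬ).val.toLinearMap).map
    ((diagIdeal 𝒜 ℬ J).ringCon.mkₐ k).toLinearMap

end Tensor

variable (q : Fin n → Fin n → k) (q' : Fin m → Fin m → k)

/-- The two-sided ideal `J = (f, g)` of `A ⊗ B`, for quantum polynomial rings `A` and `B` and their
Fermat elements `f` and `g`. -/
def idealJ : TwoSidedIdeal (QuantumPoly q ⊗[k] QuantumPoly q') :=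
  TwoSidedIdeal.span {QuantumPoly.fermat q ⊗ₜ[k] 1, 1 ⊗ₜ[k] QuantumPoly.fermat q'}

/-- The moduli space of point modules of the bigraded algebra `A ⊗ B / J`. -/
abbrev TensorPointModuli : Type _ :=
  PointModuli (tensorQuotDeg (QuantumPoly.deg q) (QuantumPoly.deg q') (idealJ q q'))

/-- The moduli space of point modules of the graded algebra `A ∘ B / J_Δ`. -/
abbrev SegrePointModuli : Type _ :=
  PointModuli (segreQuotDeg (QuantumPoly.deg q) (QuantumPoly.deg q') (idealJ q q'))

end Algebras

/-! ### Conditions on the parameters -/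

section Parameters

variable {k : Type*} [Field k] {n : ℕ}

/-- The standing conditions `q_{ii} = q_{ij} q_{ji} = q_{ij}^n = 1` in `n` variables. -/
structure IsQuantumParameter (q : Fin n → Fin n → k) : Prop where
  diag : ∀ i, q i i = 1
  mul_swap : ∀ i j, q i j * q j i = 1
  pow_eq_one : ∀ i j, q i j ^ n = 1

/-- The Calabi–Yau condition: `∏_i q_{ij}` does not depend on `j`. -/
def IsCalabiYauParameter (q : Fin n → Fin n → k) : Prop :=
  ∀ j j' : Fin n, ∏ i, q i j = ∏ i, q i j'

/-- `{q_{ij}}` is special if `q_{ij} q_{jl} q_{li} = 1` for all `i, j, l`. -/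
def IsSpecialParameter (q : Fin n → Fin n → k) : Prop :=
  ∀ i j l : Fin n, q i j * q j l * q l i = 1

/-- `{q_{ij}}` is general if it is not special. -/
def IsGeneralParameter (q : Fin n → Fin n → k) : Prop :=
  ¬ IsSpecialParameter q

end Parameters

end

open scoped TensorProduct

noncomputable section

/-! ### A topological criterion for Krull dimension one. -/

section Topology

open TopologicalSpace Set Topology

/-! Choose a basis vector in each component of a point module. The generators then act by scalars:
`x_i` sends the `d`-th basis vector to `P d i` times the next one, and similarly `y_j` with a
sequence `R`. The relations of the algebra say exactly that `P` and `R` satisfy the skew commutation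
rule and the Fermat equation of `IsPointSeq`. Conversely, every such pair acts by weighted shifts on
the free vector space on `ℕ × ℕ`, and thus defines a point module of `A ⊗ B / J`; its diagonal gives
one of `A ∘ B / J_Δ`. For the Segre product the module only provides the scalars by which the `x_i ⊗
y_j` act, but the commutation rule makes each of these matrices of rank one, so the same pairs `(P,
R)` occur. Both algebras are therefore treated at once through `PointParametrization`.

A point sequence is determined up to rescaling by its initial vector (`IsPointSeq.proportional`), so
the moduli space is governed by the possible initial vectors. If three coordinates `i, j, l` of `P
0` are nonzero, then `q i j * q j l * q l i = 1` (`IsPointSeq.triple_eq_one`). In four variables the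
Calabi–Yau condition makes the triples `{i, j, l}` and `{i, j, m}` inverse to each other, so a
single trivial triple would make all of them trivial. For general parameters `P 0` thus has at most
two nonzero coordinates, and the Fermat equation leaves finitely many choices up to scalar
(`IsPointSeq.exists_edgeVector`). In three variables the Calabi–Yau condition makes the parameters
special; a twist by powers of `q' 0 i` then turns the Fermat equation into the ordinary one, and `R
0` runs over the whole Fermat cubic.

Hence the moduli space is a nonempty finite union of curves, each the image of the Fermat cubic.
With one initial vector `P 0` fixed, the coordinates of the module are polynomials in the point of
the cubic. By irreducibility of the cubic, each closed set contains such a curve or meets it in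
finitely many points. So the irreducible closed sets are the points and the curves. -/

/-- A T1 space which is a finite union of infinite closed subsets `W s`, each of which meets every
closed set in a finite set or is contained in it, has Krull dimension one. -/
theorem topologicalKrullDim_eq_one_of_cofinite_cover {X F : Type*} [TopologicalSpace X] [Finite F]
    [Nonempty F] (W : F → Set X) (hcover : ∀ x, ∃ s, x ∈ W s) (hpt : ∀ x : X, IsClosed {x})
    (hclosed : ∀ s, IsClosed (W s)) (hinf : ∀ s, (W s).Infinite)
    (hsub : ∀ s t, W s ⊆ W t → W t ⊆ W s)
    (hcof : ∀ s (Z : Set X), IsClosed Z → (Z ∩ W s).Finite ∨ W s ⊆ Z) :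
    topologicalKrullDim X = 1 := by
  have hirr : ∀ s, IsIrreducible (W s) := by
    intro s
    refine ⟨(hinf s).nonempty, isPreirreducible_iff_isClosed_union_isClosed.2 ?_⟩
    intro Z₁ Z₂ h₁ h₂ h
    by_contra! hcon
    have f₁ := (hcof s Z₁ h₁).resolve_right hcon.1
    have f₂ := (hcof s Z₂ h₂).resolve_right hcon.2
    exact hinf s ((f₁.union f₂).subset fun x hx => (h hx).imp (⟨·, hx⟩) (⟨·, hx⟩))
  have hclass : ∀ Z : IrreducibleCloseds X, (∃ x, (Z : Set X) = {x}) ∨ ∃ s, (Z : Set X) = W s := by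
    intro Z
    obtain ⟨s, hs⟩ : ∃ s, (Z : Set X) ⊆ W s := by
      have := (isIrreducible_iff_sUnion_isClosed.1 Z.isIrreducible) (Set.finite_range W).toFinset
        (by simpa using hclosed) (by
          intro x _
          obtain ⟨s, hs⟩ := hcover x
          exact ⟨W s, by simp, hs⟩)
      obtain ⟨_, h, h'⟩ := this
      simp only [Finite.mem_toFinset, mem_range] at h
      obtain ⟨s, rfl⟩ := h
      exact ⟨s, h'⟩
    rcases hcof s Z Z.isClosed with hf | hf
    · left
      rw [inter_eq_left.2 hs] at hf
      have := (isIrreducible_iff_sUnion_isClosed.1 Z.isIrreducible)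
        (hf.image (fun x => ({x} : Set X))).toFinset
        (by
          intro z hz
          simp only [Finite.mem_toFinset, mem_image] at hz
          obtain ⟨x, -, rfl⟩ := hz
          exact hpt x) (by
          intro x hx
          exact ⟨{x}, by simpa using hx, rfl⟩)
      obtain ⟨_, h, h'⟩ := this
      simp only [Finite.mem_toFinset, mem_image] at h
      obtain ⟨x, -, rfl⟩ := h
      exact ⟨x, (Set.Nonempty.subset_singleton_iff Z.isIrreducible.nonempty).1 h'⟩
    · exact Or.inr ⟨s, hs.antisymm hf⟩
  apply le_antisymm
  -- By `hclass` an irreducible closed set is a point, hence minimal, or some `W s`, which is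
  -- maximal by `hsub`.
  · refine Order.krullDim_le_one_iff.2 fun Z => ?_
    rcases hclass Z with ⟨x, hx⟩ | ⟨s, hs⟩
    · left
      intro Y hY
      have hY' : (Y : Set X) ⊆ {x} := hx ▸ hY
      have := (Set.Nonempty.subset_singleton_iff Y.isIrreducible.nonempty).1 hY'
      exact le_of_eq (SetLike.coe_injective (hx.trans this.symm))
    · right
      intro Y hY
      have hY' : W s ⊆ (Y : Set X) := hs ▸ hY
      rcases hclass Y with ⟨x, hx⟩ | ⟨t, ht⟩
      · exact absurd ((finite_singleton x).subset (hx ▸ hY')) (hinf s)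
      · have : (Y : Set X) ⊆ Z := by
          rw [ht, hs]
          exact hsub s t (ht ▸ hY')
        exact this
  · obtain ⟨s⟩ := ‹Nonempty F›
    obtain ⟨x, hx⟩ := (hinf s).nonempty
    refine Order.one_le_krullDim_iff.2 ⟨⟨{x}, isIrreducible_singleton, hpt x⟩,
      ⟨W s, hirr s, hclosed s⟩, ?_⟩
    refine lt_of_le_of_ne (show ({x} : Set X) ⊆ W s from by simpa using hx) fun h => ?_
    have h' : ({x} : Set X) = W s := congrArg IrreducibleCloseds.carrier h
    exact hinf s (h' ▸ finite_singleton x)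

/-- In a topology generated by a family of sets, the property of a subset `W` that every closed
set contains `W` or meets it in a finite set can be tested on the generators. -/
theorem finite_inter_or_subset_of_isClosed_generateFrom {X : Type*} {g : Set (Set X)} {W : Set X}
    (h : ∀ U ∈ g, (W \ U).Finite ∨ Disjoint W U) {Z : Set X}
    (hZ : IsClosed[TopologicalSpace.generateFrom g] Z) : (Z ∩ W).Finite ∨ W ⊆ Z := by
  -- The dual condition on open sets is stable under finite intersections and arbitrary unions, so
  -- it passes from the generators to all open sets.
  have key : ∀ U : Set X, TopologicalSpace.GenerateOpen g U →
      (W \ U).Finite ∨ Disjoint W U := by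
    intro U hU
    induction hU with
    | basic s hs => exact h s hs
    | univ => left; simp
    | inter s t _ _ hs ht =>
      rcases hs with hs | hs
      · rcases ht with ht | ht
        · left; rw [sdiff_inter]; exact hs.union ht
        · right; exact ht.mono_right inter_subset_right
      · right; exact hs.mono_right inter_subset_left
    | sUnion S _ ih =>
      by_cases hS : ∃ s ∈ S, (W \ s).Finite
      · obtain ⟨s, hs, hf⟩ := hS
        exact Or.inl (hf.subset (sdiff_subset_sdiff_right (subset_sUnion_of_mem hs)))
      · push Not at hS
        exact Or.inr (disjoint_sUnion_right.2 fun s hs => (ih s hs).resolve_left (hS s hs))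
  have hU := key Zᶜ ((@isOpen_compl_iff X Z (TopologicalSpace.generateFrom g)).2 hZ)
  rwa [sdiff_compl, inter_comm, disjoint_compl_right_iff_subset] at hU

end Topology

/-! ### Irreducibility of the Fermat cubic and zeros of polynomials on it. -/

section Cubic

open Polynomial

variable {k : Type*} [Field k]

/-- Eisenstein's criterion at the prime `X + 1`: in characteristic zero `-1` is a simple root of the
constant term `X ^ 3 + 1`, whose derivative there is `3`. -/
theorem irreducible_fermat_cubic [CharZero k] :
    Irreducible (X ^ 3 + C (X ^ 3 + 1) : k[X][X]) := by
  have hP : (Ideal.span {(X + 1 : k[X])}).IsPrime := by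
    rw [Ideal.span_singleton_prime (by simpa using X_add_C_ne_zero (1 : k))]
    simpa using prime_X_sub_C (-1 : k)
  have hdeg : (X ^ 3 + C (X ^ 3 + 1) : k[X][X]).degree = 3 := degree_X_pow_add_C (by norm_num) _
  have hmonic : (X ^ 3 + C (X ^ 3 + 1) : k[X][X]).Monic := monic_X_pow_add_C _ (by norm_num)
  have hroot : ∀ f : k[X], (X + 1 ∣ f) ↔ f.eval (-1) = 0 := by
    intro f
    have := dvd_iff_isRoot (p := f) (a := -1)
    simpa using this
  have hcoeff : ∀ n < 3, (X ^ 3 + C (X ^ 3 + 1) : k[X][X]).coeff n =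
      if n = 0 then X ^ 3 + 1 else 0 := by
    intro n hn
    rw [coeff_add, coeff_X_pow, coeff_C, if_neg (by lia), zero_add]
  refine irreducible_of_eisenstein_criterion hP ?_ ?_ ?_ ?_ hmonic.isPrimitive
  · rw [hmonic.leadingCoeff, ← Ideal.eq_top_iff_one]
    exact hP.ne_top
  · intro n hn
    rw [hdeg] at hn
    have hn' : n < 3 := by exact_mod_cast hn
    rw [Ideal.mem_span_singleton, hroot, hcoeff n hn']
    split_ifs <;> norm_num
  · rw [hdeg]; norm_num
  · rw [Ideal.span_singleton_pow, Ideal.mem_span_singleton, hcoeff 0 (by norm_num), if_pos rfl]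
    rintro ⟨g, hg⟩
    have h := congrArg (fun f => (derivative f).eval (-1)) hg
    simp [derivative_mul, derivative_pow] at h

/-- If `f` does not divide `G`, then `G` is a nonzero element of the domain `AdjoinRoot f`, which is
integral over `k[X]`. The ideal it generates therefore contains a nonzero `h` from `k[X]`. The first
coordinates of the common zeros are roots of `h`, and each allows at most three second coordinates.
-/
theorem finite_zeros_or_eq_zero_on_affine_fermat_cubic [CharZero k] (G : k[X][X]) :
    {p : k × k | p.1 ^ 3 + p.2 ^ 3 + 1 = 0 ∧ (G.map (evalRingHom p.1)).eval p.2 = 0}.Finite ∨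
      ∀ p : k × k, p.1 ^ 3 + p.2 ^ 3 + 1 = 0 → (G.map (evalRingHom p.1)).eval p.2 = 0 := by
  classical
  set f : k[X][X] := X ^ 3 + C (X ^ 3 + 1) with hf
  have hfev : ∀ p : k × k, (f.map (evalRingHom p.1)).eval p.2 = p.1 ^ 3 + p.2 ^ 3 + 1 := by
    intro p; simp [hf]; ring
  have hmonic : f.Monic := monic_X_pow_add_C _ (by norm_num)
  by_cases hdvd : f ∣ G
  · right
    rintro p hp
    obtain ⟨u, rfl⟩ := hdvd
    rw [Polynomial.map_mul, eval_mul, hfev, hp, zero_mul]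
  · left
    have hprime : Prime f := irreducible_fermat_cubic.prime
    have : (Ideal.span {f}).IsPrime := by
      rwa [Ideal.span_singleton_prime hprime.ne_zero]
    let S := AdjoinRoot f
    have : IsDomain S := Ideal.Quotient.isDomain _
    have hG : AdjoinRoot.mk f G ≠ 0 := by
      rwa [Ne, AdjoinRoot.mk_eq_zero]
    have hint : IsIntegral k[X] (AdjoinRoot.mk f G) := by
      have : Module.Finite k[X] (AdjoinRoot f) := hmonic.finite_adjoinRoot
      exact Algebra.IsIntegral.isIntegral _
    have hne := Ideal.comap_ne_bot_of_integral_mem (I := Ideal.span {AdjoinRoot.mk f G}) hG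
      (Ideal.mem_span_singleton_self _) hint
    obtain ⟨h, hh, hh0⟩ := Submodule.exists_mem_ne_zero_of_ne_bot hne
    rw [Ideal.mem_comap, Ideal.mem_span_singleton] at hh
    obtain ⟨u, hu⟩ := hh
    obtain ⟨u, rfl⟩ := AdjoinRoot.mk_surjective u
    rw [← map_mul, AdjoinRoot.algebraMap_eq, ← AdjoinRoot.mk_C, AdjoinRoot.mk_eq_mk] at hu
    obtain ⟨v, hv⟩ := hu
    have hsub : {p : k × k | p.1 ^ 3 + p.2 ^ 3 + 1 = 0 ∧ (G.map (evalRingHom p.1)).eval p.2 = 0} ⊆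
        ⋃ a ∈ (h.roots.toFinset : Set k),
          (fun b => (a, b)) '' (((X ^ 3 + C (a ^ 3 + 1) : k[X]).roots.toFinset : Finset k) :
            Set k) := by
      rintro ⟨a, b⟩ ⟨h1, h2⟩
      have h3 := congrArg (fun w => (w.map (evalRingHom a)).eval b) hv
      have h4 := hfev (a, b)
      simp only at h1 h2 h4
      simp only [Polynomial.map_sub, Polynomial.map_mul, eval_sub, eval_mul, h2, h4, h1,
        zero_mul, sub_zero, map_C, eval_C, coe_evalRingHom] at h3
      simp only [Set.mem_iUnion, Set.mem_image, Finset.mem_coe, Multiset.mem_toFinset]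
      refine ⟨a, (mem_roots hh0).2 h3, b, ?_, rfl⟩
      rw [mem_roots (monic_X_pow_add_C (a ^ 3 + 1) (by norm_num)).ne_zero]
      simp only [IsRoot.def, eval_add, eval_pow, eval_X, eval_C]
      linear_combination h1
    exact ((Finset.finite_toSet _).biUnion fun a _ => (Finset.finite_toSet _).image _).subset hsub

/-- The points of the Fermat cubic with `i`-th coordinate `1`. -/
def fermatCubicChart (k : Type*) [Field k] (i : Fin 3) : Set (Fin 3 → k) :=
  {r | r i = 1 ∧ ∑ j, r j ^ 3 = 0}

/-- The vector with coordinates `1, a, b` in cyclic order, starting at the index `i`. -/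
def chartVector (i : Fin 3) (a b : k) (j : Fin 3) : k :=
  if j = i then 1 else if j = i + 1 then a else b

theorem sum_chartVector_pow (i : Fin 3) (a b : k) :
    ∑ j, chartVector i a b j ^ 3 = a ^ 3 + b ^ 3 + 1 := by
  fin_cases i <;> simp [chartVector, Fin.sum_univ_three] <;> ring

theorem eq_chartVector {i : Fin 3} {r : Fin 3 → k} (h : r i = 1) :
    r = chartVector i (r (i + 1)) (r (i + 2)) := by
  funext j
  fin_cases i <;> fin_cases j <;> simp_all [chartVector]

theorem finite_zeros_or_eq_zero_on_fermatCubicChart [CharZero k] (G : MvPolynomial (Fin 3) k)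
    (i : Fin 3) : {r ∈ fermatCubicChart k i | MvPolynomial.eval r G = 0}.Finite ∨
      ∀ r ∈ fermatCubicChart k i, MvPolynomial.eval r G = 0 := by
  -- Dehomogenization: the `i`-th variable becomes `1`, and the next two in cyclic order become the
  -- inner and the outer variable.
  let H : k[X][X] := MvPolynomial.aeval
    (fun j => if j = i then 1 else if j = i + 1 then C X else X) G
  have hH : ∀ a b, (H.map (evalRingHom a)).eval b = MvPolynomial.eval (chartVector i a b) G := by
    intro a b
    simp only [H]
    induction G using MvPolynomial.induction_on with
    | C c => simp
    | add p q hp hq => simp only [map_add, Polynomial.map_add, eval_add, hp, hq]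
    | mul_X p j hp =>
      simp only [map_mul, Polynomial.map_mul, eval_mul, hp, MvPolynomial.aeval_X,
        MvPolynomial.eval_X, chartVector]
      split_ifs <;> simp
  have hmem : ∀ r ∈ fermatCubicChart k i, r = chartVector i (r (i + 1)) (r (i + 2)) ∧
      r (i + 1) ^ 3 + r (i + 2) ^ 3 + 1 = 0 := by
    rintro r ⟨h1, h2⟩
    have h := eq_chartVector h1
    refine ⟨h, ?_⟩
    rw [← sum_chartVector_pow i, ← h, h2]
  refine (finite_zeros_or_eq_zero_on_affine_fermat_cubic H).imp (fun h => ?_) (fun h r hr => ?_)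
  · refine (h.image fun p => chartVector i p.1 p.2).subset ?_
    rintro r ⟨hr, hr0⟩
    obtain ⟨h1, h2⟩ := hmem r hr
    refine ⟨(r (i + 1), r (i + 2)), ⟨h2, ?_⟩, h1.symm⟩
    rw [hH, ← h1, hr0]
  · obtain ⟨h1, h2⟩ := hmem r hr
    rw [h1, ← hH]
    exact h (_, _) h2

theorem infinite_fermatCubicChart [IsAlgClosed k] [CharZero k] (i : Fin 3) :
    (fermatCubicChart k i).Infinite := by
  have hex : ∀ a : k, ∃ b : k, b ^ 3 = -(a ^ 3 + 1) := fun a =>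
    IsAlgClosed.exists_pow_nat_eq _ (by norm_num)
  choose b hb using hex
  refine Set.infinite_of_injective_forall_mem (f := fun a => chartVector i a (b a)) ?_ ?_
  · intro a a' h
    have := congrFun h (i + 1)
    fin_cases i <;> simpa [chartVector] using this
  · intro a
    refine ⟨by simp [chartVector], ?_⟩
    rw [sum_chartVector_pow, hb]
    ring

/-- Only finitely many points of a chart of the Fermat cubic lie outside another chart. -/
theorem infinite_fermatCubicChart_ne_zero [IsAlgClosed k] [CharZero k] (i j : Fin 3) :
    {r ∈ fermatCubicChart k i | r j ≠ 0}.Infinite := by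
  have h := (finite_zeros_or_eq_zero_on_fermatCubicChart (MvPolynomial.X j : MvPolynomial _ k) i)
  have hfin : {r ∈ fermatCubicChart k i | r j = 0}.Finite := by
    simp only [MvPolynomial.eval_X] at h
    refine h.resolve_right fun h => ?_
    -- To see that `r j` does not vanish identically on the chart, use points with coordinates `1`,
    -- `b`, `0`: the entry `b` goes to index `i + 1` if that is `j`, and to `i + 2` otherwise.
    obtain ⟨b, hb⟩ : ∃ b : k, b ^ 3 = -1 := IsAlgClosed.exists_pow_nat_eq _ (by norm_num)
    have hb0 : b ≠ 0 := by
      rintro rfl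
      norm_num at hb
    obtain ⟨r, hr, hrj⟩ : ∃ r ∈ fermatCubicChart k i, r j ≠ 0 := by
      by_cases hij : j = i + 1
      · refine ⟨chartVector i b 0, ⟨by simp [chartVector], ?_⟩, ?_⟩
        · rw [sum_chartVector_pow, hb]; ring
        · simp only [chartVector, hij]; split_ifs <;> simp [hb0]
      · refine ⟨chartVector i 0 b, ⟨by simp [chartVector], ?_⟩, ?_⟩
        · rw [sum_chartVector_pow, hb]; ring
        · simp only [chartVector, hij]; split_ifs <;> simp_all
    exact hrj (h r hr)
  refine fun h' => infinite_fermatCubicChart i ((hfin.union h').subset fun r hr => ?_)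
  by_cases h0 : r j = 0
  · exact Or.inl ⟨hr, h0⟩
  · exact Or.inr ⟨hr, h0⟩

end Cubic

/-! ### Multihomogeneous polynomials under rescaling. -/

section Multihomogeneous

variable {k C ι : Type*} [Field k] [Ring C] [Algebra k C] {𝒞 : ι → Submodule k C}

/-- All monomials have the same degree `n d` in the coordinates of degree `d`, so they pick up the
same factor. Vanishing is thus independent of the choice of bases in a point module. -/
theorem IsMultihomogeneous.eval_scale {p : MvPolynomial (Σ d, 𝒞 d) k} (hp : IsMultihomogeneous p) :
    ∃ n : ι →₀ ℕ, ∀ (c : ι → k) (φ : (Σ d, 𝒞 d) → k),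
      MvPolynomial.eval (fun s => c s.1 * φ s) p = (n.prod fun d e => c d ^ e) *
        MvPolynomial.eval φ p := by
  obtain ⟨n, hn⟩ := hp
  refine ⟨n, fun c φ => ?_⟩
  rw [MvPolynomial.eval_eq, MvPolynomial.eval_eq, Finset.mul_sum]
  refine Finset.sum_congr rfl fun m hm => ?_
  have hw := hn (MvPolynomial.mem_support_iff.1 hm)
  have hprod : ∏ s ∈ m.support, c s.1 ^ m s = n.prod fun d e => c d ^ e := by
    rw [← hw, Finsupp.weight_apply, Finsupp.prod_sum_index (by simp) (by intros; rw [pow_add])]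
    refine Finset.prod_congr rfl fun s _ => ?_
    simp only [Finsupp.smul_single]
    rw [Finsupp.prod_single_index (by simp)]
    simp
  simp only [mul_pow, Finset.prod_mul_distrib]
  rw [hprod]
  ring

theorem isMultihomogeneous_sub (D : ι) (a b : 𝒞 D) (x y : k) :
    IsMultihomogeneous (MvPolynomial.C x * MvPolynomial.X ⟨D, a⟩ -
      MvPolynomial.C y * MvPolynomial.X ⟨D, b⟩ : MvPolynomial (Σ d, 𝒞 d) k) := by
  refine ⟨Finsupp.single D 1, ?_⟩
  have h : ∀ (x : k) (a : 𝒞 D), MvPolynomial.IsWeightedHomogeneous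
      (fun s : (Σ d, 𝒞 d) => Finsupp.single s.1 1)
      (MvPolynomial.C x * MvPolynomial.X ⟨D, a⟩) (Finsupp.single D 1) := fun x a => by
    simpa using (MvPolynomial.isWeightedHomogeneous_C _ x).mul
      (MvPolynomial.isWeightedHomogeneous_X k (fun s : (Σ d, 𝒞 d) => Finsupp.single s.1 1) ⟨D, a⟩)
  exact (MvPolynomial.weightedHomogeneousSubmodule k _ _).sub_mem (h x a) (h y b)

end Multihomogeneous

/-! ### Point modules, their coordinates, and their isomorphism classes. -/

section PointModuleTheory

universe u v w

variable {k : Type u} [Field k] {C : Type v} [Ring C] [Algebra k C]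
  {ι : Type w} [AddMonoid ι] [DecidableEq ι] {𝒞 : ι → Submodule k C}

open MulOpposite

namespace PointModule

theorem op_smul_smul (M : PointModule 𝒞) (c : k) (a : C) (m : M.carrier) :
    op (c • a) • m = c • (op a • m) := by
  rw [op_smul, smul_assoc]

theorem smul_op_smul (M : PointModule 𝒞) (c : k) (x : Cᵐᵒᵖ) (m : M.carrier) :
    x • (c • m) = c • (x • m) := by
  rw [← one_smul Cᵐᵒᵖ m, ← smul_assoc c (1 : Cᵐᵒᵖ) m, ← mul_smul, ← mul_smul, mul_smul_comm,
    smul_assoc]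

theorem op_mul_smul (M : PointModule 𝒞) (a b : C) (m : M.carrier) :
    op (a * b) • m = op b • (op a • m) := by
  rw [op_mul, mul_smul]

theorem linearIndependent_of_mem_comp (M : PointModule 𝒞) {m : ι → M.carrier}
    (hm : ∀ d, m d ∈ M.comp d ∧ m d ≠ 0) : LinearIndependent k m :=
  (M.isInternal.submodule_iSupIndep).linearIndependent _ (fun d => (hm d).1) (fun d => (hm d).2)

theorem exists_smul_eq (M : PointModule 𝒞) {d : ι} {m n : M.carrier} (hm : m ∈ M.comp d)
    (hm0 : m ≠ 0) (hn : n ∈ M.comp d) : ∃ c : k, n = c • m := by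
  have h0 : (⟨m, hm⟩ : M.comp d) ≠ 0 := fun h => hm0 (congrArg Subtype.val h)
  obtain ⟨c, hc⟩ := (finrank_eq_one_iff_of_nonzero' _ h0).1 (M.finrank_comp d) ⟨n, hn⟩
  exact ⟨c, (congrArg Subtype.val hc).symm⟩

theorem exists_ne_zero (M : PointModule 𝒞) (d : ι) : ∃ m ∈ M.comp d, m ≠ 0 := by
  obtain ⟨⟨m, hm⟩, h0, -⟩ := finrank_eq_one_iff'.1 (M.finrank_comp d)
  exact ⟨m, hm, fun h => h0 (Subtype.ext h)⟩

theorem op_smul_mem (M : PointModule 𝒞) {d : ι} {m : M.carrier} {a : C} (hm : m ∈ M.comp 0)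
    (ha : a ∈ 𝒞 d) : op a • m ∈ M.comp d := by
  simpa using M.smul_mem hm ha

theorem exists_op_smul_eq (M : PointModule 𝒞) {m : M.carrier} (hm : m ∈ M.comp 0) (hm0 : m ≠ 0)
    (n : M.carrier) : ∃ a : C, op a • m = n := by
  obtain ⟨g, hg, hspan⟩ := M.cyclic
  obtain ⟨c, rfl⟩ := M.exists_smul_eq hm hm0 hg
  have hn : n ∈ Submodule.span Cᵐᵒᵖ {c • m} := hspan ▸ Submodule.mem_top
  obtain ⟨x, rfl⟩ := Submodule.mem_span_singleton.1 hn
  exact ⟨c • x.unop, by rw [op_smul_smul, op_unop, smul_op_smul]⟩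

/-- The degree-zero generator of a point module together with `k`-bases of the components. -/
theorem exists_basis (M : PointModule 𝒞) :
    ∃ m : ι → M.carrier, ∀ d, m d ∈ M.comp d ∧ m d ≠ 0 := by
  choose m hm using M.exists_ne_zero
  exact ⟨m, hm⟩

theorem op_sum_smul (M : PointModule 𝒞) {m : ι → M.carrier} {φ : (Σ d, 𝒞 d) → k}
    (hφ : ∀ d (a : 𝒞 d), op (a : C) • m 0 = φ ⟨d, a⟩ • m d) (f : ι →₀ C)
    (hf : ∀ d, f d ∈ 𝒞 d) :
    op (f.sum fun _ a => a) • m 0 = ∑ d ∈ f.support, φ ⟨d, ⟨f d, hf d⟩⟩ • m d := by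
  rw [Finsupp.sum, Finset.op_sum, Finset.sum_smul]
  exact Finset.sum_congr rfl fun d _ => hφ d ⟨f d, hf d⟩

/-- By cyclicity `m` generates the module. If `𝒞 d` killed `m`, everything generated would lie in
the components of degree different from `d`. -/
theorem exists_op_smul_ne_zero (hC : ⨆ d, 𝒞 d = ⊤) (M : PointModule 𝒞) {m : M.carrier}
    (hm : m ∈ M.comp 0) (hm0 : m ≠ 0) (d : ι) : ∃ a ∈ 𝒞 d, op a • m ≠ 0 := by
  obtain ⟨n, hn⟩ := M.exists_basis
  by_contra! hcon
  obtain ⟨a, ha⟩ := M.exists_op_smul_eq hm hm0 (n d)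
  have ha' : a ∈ ⨆ d, 𝒞 d := hC ▸ Submodule.mem_top
  obtain ⟨f, hf, rfl⟩ := (Submodule.mem_iSup_iff_exists_finsupp _ _).1 ha'
  have hc : ∀ e, ∃ c : k, op (f e) • m = c • n e := fun e =>
    M.exists_smul_eq (hn e).1 (hn e).2 (M.op_smul_mem hm (hf e))
  choose c hc using hc
  rw [Finsupp.sum, Finset.op_sum, Finset.sum_smul, Finset.sum_congr rfl fun e _ => hc e] at ha
  have hli := M.linearIndependent_of_mem_comp hn
  have hmem : n d ∈ Submodule.span k (n '' {e | e ≠ d}) := by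
    rw [← ha]
    refine Submodule.sum_mem _ fun e _ => ?_
    by_cases hed : e = d
    · subst hed
      rw [← hc, hcon _ (hf e)]
      exact zero_mem _
    · exact Submodule.smul_mem _ _ (Submodule.subset_span ⟨e, hed, rfl⟩)
  exact hli.notMem_span_image (s := {e | e ≠ d}) (by simp) hmem

/-- Coordinates of isomorphic point modules agree up to rescaling in each degree. -/
theorem IsCoord.exists_scale {M N : PointModule 𝒞} {φ ψ : (Σ d, 𝒞 d) → k} (hφ : M.IsCoord φ)
    (hψ : N.IsCoord ψ) (h : M.Iso N) :
    ∃ c : ι → k, (∀ d, c d ≠ 0) ∧ ∀ s, ψ s = c s.1 * φ s := by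
  obtain ⟨e, he⟩ := h
  obtain ⟨m, hm, hφ⟩ := hφ
  obtain ⟨n, hn, hψ⟩ := hψ
  have hem : ∀ d, ∃ c : k, e (m d) = c • n d := fun d =>
    N.exists_smul_eq (hn d).1 (hn d).2 ((he d _).1 (hm d).1)
  choose c hc using hem
  have hc0 : ∀ d, c d ≠ 0 := by
    intro d h
    have h' := hc d
    rw [h, zero_smul] at h'
    exact (hm d).2 (e.map_eq_zero_iff.1 h')
  have hlin : ∀ (b : k) x, e (b • x) = b • e x := by
    intro b x
    rw [← one_smul Cᵐᵒᵖ x, ← smul_assoc, map_smul, smul_assoc, one_smul]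
    simp
  -- The isomorphism rescales the generator in degree `0` as well as the target vector in degree
  -- `d`, whence the quotient of the two factors.
  refine ⟨fun d => (c 0)⁻¹ * c d, fun d => mul_ne_zero (inv_ne_zero (hc0 0)) (hc0 d), ?_⟩
  rintro ⟨d, a⟩
  have h1 := congrArg e (hφ d a)
  rw [map_smul, hc, smul_op_smul, hψ, hlin, hc, smul_smul, smul_smul] at h1
  have h2 := smul_left_injective k (hn d).2 h1
  have := hc0 0
  field_simp
  linear_combination h2

/-- The condition `c 0 = 1` is needed because `m 0` is both the generator and the basis vector of
degree `0`. -/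
theorem IsCoord.rescale {M : PointModule 𝒞} {φ ψ : (Σ d, 𝒞 d) → k} (hφ : M.IsCoord φ)
    (c : ι → k) (hc : ∀ d, c d ≠ 0) (hc0 : c 0 = 1) (h : ∀ s, ψ s = c s.1 * φ s) : M.IsCoord ψ := by
  obtain ⟨m, hm, hφ⟩ := hφ
  refine ⟨fun d => (c d)⁻¹ • m d, fun d => ⟨Submodule.smul_mem _ _ (hm d).1, ?_⟩, fun d a => ?_⟩
  · exact smul_ne_zero (inv_ne_zero (hc d)) (hm d).2
  · beta_reduce
    rw [hc0, inv_one, one_smul, hφ, h, smul_smul, mul_right_comm, mul_inv_cancel₀ (hc d), one_mul]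

/-- The components are independent, so the annihilator of the generator is read off from the
coordinates degree by degree. Hence modules with equal coordinates are the same quotient of `Cᵐᵒᵖ`.
-/
theorem IsCoord.op_smul_eq_zero (hC : ⨆ d, 𝒞 d = ⊤) {M N : PointModule 𝒞} {φ : (Σ d, 𝒞 d) → k}
    {m : ι → M.carrier} {n : ι → N.carrier} (hm : ∀ d, m d ∈ M.comp d ∧ m d ≠ 0)
    (hφ : ∀ d (a : 𝒞 d), op (a : C) • m 0 = φ ⟨d, a⟩ • m d)
    (hψ : ∀ d (a : 𝒞 d), op (a : C) • n 0 = φ ⟨d, a⟩ • n d) {a : C} (ha : op a • m 0 = 0) :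
    op a • n 0 = 0 := by
  have ha' : a ∈ ⨆ d, 𝒞 d := hC ▸ Submodule.mem_top
  obtain ⟨f, hf, rfl⟩ := (Submodule.mem_iSup_iff_exists_finsupp _ _).1 ha'
  rw [M.op_sum_smul hφ f hf] at ha
  rw [N.op_sum_smul hψ f hf]
  have h0 := linearIndependent_iff'.1 (M.linearIndependent_of_mem_comp hm) _ _ ha
  exact Finset.sum_eq_zero fun d hd => by rw [h0 d hd, zero_smul]

/-- Point modules with the same coordinates are isomorphic. -/
theorem IsCoord.iso (hC : ⨆ d, 𝒞 d = ⊤) {M N : PointModule 𝒞} {φ : (Σ d, 𝒞 d) → k}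
    (hM : M.IsCoord φ) (hN : N.IsCoord φ) : M.Iso N := by
  obtain ⟨m, hm, hφ⟩ := hM
  obtain ⟨n, hn, hψ⟩ := hN
  let f := LinearMap.toSpanSingleton Cᵐᵒᵖ M.carrier (m 0)
  let g := LinearMap.toSpanSingleton Cᵐᵒᵖ N.carrier (n 0)
  have hf : Function.Surjective f := fun x => by
    obtain ⟨a, ha⟩ := M.exists_op_smul_eq (hm 0).1 (hm 0).2 x
    exact ⟨op a, ha⟩
  have hg : Function.Surjective g := fun x => by
    obtain ⟨a, ha⟩ := N.exists_op_smul_eq (hn 0).1 (hn 0).2 x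
    exact ⟨op a, ha⟩
  have hker : LinearMap.ker f = LinearMap.ker g := by
    ext x
    exact ⟨fun h => op_smul_eq_zero hC hm hφ hψ (a := x.unop) h,
      fun h => op_smul_eq_zero hC hn hψ hφ (a := x.unop) h⟩
  let e : M.carrier ≃ₗ[Cᵐᵒᵖ] N.carrier := (f.quotKerEquivOfSurjective hf).symm.trans
    ((Submodule.quotEquivOfEq _ _ hker).trans (g.quotKerEquivOfSurjective hg))
  have he : ∀ a : C, e (op a • m 0) = op a • n 0 := by
    intro a
    have h1 : (f.quotKerEquivOfSurjective hf).symm (op a • m 0) = Submodule.Quotient.mk (op a) := by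
      rw [LinearEquiv.symm_apply_eq]
      rfl
    simp only [e, LinearEquiv.trans_apply, h1]
    rfl
  have hlin : ∀ (b : k) x, e (b • x) = b • e x := by
    intro b x
    rw [← one_smul Cᵐᵒᵖ x, ← smul_assoc, map_smul, smul_assoc, one_smul]
    simp
  have hd : ∀ d, e (m d) = n d := by
    intro d
    obtain ⟨a, ha, ha0⟩ := M.exists_op_smul_ne_zero hC (hm 0).1 (hm 0).2 d
    have h1 := he a
    rw [hφ d ⟨a, ha⟩, hψ d ⟨a, ha⟩, hlin] at h1
    rw [hφ d ⟨a, ha⟩] at ha0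
    exact smul_right_injective _ (left_ne_zero_of_smul ha0) h1
  refine ⟨e, fun d x => ⟨fun hx => ?_, fun hx => ?_⟩⟩
  · obtain ⟨c, rfl⟩ := M.exists_smul_eq (hm d).1 (hm d).2 hx
    rw [hlin, hd]
    exact Submodule.smul_mem _ _ (hn d).1
  · obtain ⟨c, hc⟩ := N.exists_smul_eq (hn d).1 (hn d).2 hx
    rw [← hd, ← hlin] at hc
    rw [e.injective hc]
    exact Submodule.smul_mem _ _ (hm d).1

end PointModule

theorem PointModule.IsCoord.mem_basicOpen {M : PointModule 𝒞} {φ : (Σ d, 𝒞 d) → k}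
    (hφ : M.IsCoord φ) {p : MvPolynomial (Σ d, 𝒞 d) k} (hp : IsMultihomogeneous p) :
    (Quotient.mk (PointModule.setoid 𝒞) M : PointModuli 𝒞) ∈ PointModuli.basicOpen 𝒞 p ↔
      MvPolynomial.eval φ p ≠ 0 := by
  refine ⟨?_, fun h => ⟨M, φ, rfl, hφ, h⟩⟩
  rintro ⟨N, ψ, hN, hψ, h0⟩ h
  obtain ⟨c, hc, hcs⟩ := hφ.exists_scale hψ ((PointModule.setoid 𝒞).symm (Quotient.exact hN))
  obtain ⟨n, hn⟩ := hp.eval_scale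
  apply h0
  rw [show ψ = fun s => c s.1 * φ s from funext hcs, hn, h, mul_zero]

theorem PointModuli.isOpen_basicOpen {p : MvPolynomial (Σ d, 𝒞 d) k} (hp : IsMultihomogeneous p) :
    IsOpen (PointModuli.basicOpen 𝒞 p) :=
  TopologicalSpace.isOpen_generateFrom_of_mem ⟨p, hp, rfl⟩

/-- A right `C`-module `V` with linearly independent vectors `v d` such that `𝒞 e` maps `v d` to
multiples of `v (d + e)` contains a point module, provided `v 0 · 𝒞 d ≠ 0` for all `d`. -/
theorem exists_pointModule {V : Type v} [AddCommGroup V] [Module k V]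
    (ρ : C →ₐ[k] (Module.End k V)ᵐᵒᵖ) (hC : ⨆ d, 𝒞 d = ⊤) (v : ι → V)
    (hv : LinearIndependent k v) (φ : (Σ d, 𝒞 d) → k)
    (hstep : ∀ d e, ∀ a ∈ 𝒞 e, ∃ c : k, unop (ρ a) (v d) = c • v (d + e))
    (hφ : ∀ d (a : 𝒞 d), unop (ρ a) (v 0) = φ ⟨d, a⟩ • v d) (hne : ∀ d, ∃ a, φ ⟨d, a⟩ ≠ 0) :
    ∃ M : PointModule 𝒞, M.IsCoord φ := by
  -- The point module is the span of the `v d`. The ambient space may be larger: for the Segre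
  -- product only the diagonal of the space on `ℕ × ℕ` is kept.
  let S : Submodule k V := Submodule.span k (Set.range v)
  have hS : ∀ a : C, ∀ x ∈ S, unop (ρ a) x ∈ S := by
    intro a x hx
    have ha : a ∈ ⨆ d, 𝒞 d := hC ▸ Submodule.mem_top
    induction ha using Submodule.iSup_induction' with
    | zero => simp
    | add a b _ _ ha hb => rw [map_add, unop_add, LinearMap.add_apply]; exact add_mem ha hb
    | mem e a ha =>
      induction hx using Submodule.span_induction with
      | zero => simp
      | add x y _ _ hx hy => rw [map_add]; exact add_mem hx hy
      | smul c x _ hx => rw [map_smul]; exact Submodule.smul_mem _ _ hx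
      | mem x hx =>
        obtain ⟨d, rfl⟩ := hx
        obtain ⟨c, hc⟩ := hstep d e a ha
        rw [hc]
        exact Submodule.smul_mem _ _ (Submodule.subset_span ⟨_, rfl⟩)
  let act : Cᵐᵒᵖ →+* Module.End k S :=
    { toFun := fun a => (unop (ρ a.unop)).restrict (hS a.unop)
      map_one' := by ext; simp [LinearMap.restrict_apply]
      map_mul' := by intros; ext; simp [LinearMap.restrict_apply]
      map_zero' := by ext; simp [LinearMap.restrict_apply]
      map_add' := by intros; ext; simp [LinearMap.restrict_apply] }
  let _ : Module Cᵐᵒᵖ S := Module.compHom S act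
  have hact : ∀ (a : C) (x : S), ((op a • x : S) : V) = unop (ρ a) x := fun _ _ => rfl
  let w : Module.Basis ι k S := Module.Basis.span hv
  have hw : ∀ d, (w d : V) = v d := fun d => congrArg Subtype.val (Module.Basis.span_apply hv d)
  have hgen : ∀ d, ∃ x : Cᵐᵒᵖ, x • w 0 = w d := by
    intro d
    obtain ⟨a, ha⟩ := hne d
    refine ⟨op (((φ ⟨d, a⟩)⁻¹ • a : 𝒞 d) : C), Subtype.ext ?_⟩
    rw [hact, hw, hw, Submodule.coe_smul, map_smul, unop_smul, LinearMap.smul_apply, hφ, smul_smul,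
      inv_mul_cancel₀ ha, one_smul]
  have htower : IsScalarTower k Cᵐᵒᵖ S := ⟨fun c x y => Subtype.ext <| by
    have := hact (c • x.unop) y
    rw [op_smul, op_unop] at this
    rw [this, Submodule.coe_smul, map_smul, unop_smul, LinearMap.smul_apply]
    rfl⟩
  have hspan : ⨆ d, Submodule.span k {w d} = ⊤ := by
    rw [← Submodule.span_range_eq_iSup, w.span_eq]
  refine ⟨{ carrier := S
            comp := fun d => Submodule.span k {w d}
            isInternal := DirectSum.isInternal_submodule_of_iSupIndep_of_iSup_eq_top
              w.linearIndependent.iSupIndep_span_singleton hspan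
            smul_mem := ?_
            cyclic := ?_
            finrank_comp := fun d => finrank_span_singleton (w.ne_zero d) }, w, ?_, ?_⟩
  · intro d e m a hm ha
    obtain ⟨c, rfl⟩ := Submodule.mem_span_singleton.1 hm
    obtain ⟨b, hb⟩ := hstep d e a ha
    refine Submodule.mem_span_singleton.2 ⟨c * b, Subtype.ext ?_⟩
    rw [hact, Submodule.coe_smul, Submodule.coe_smul, hw, hw, map_smul, hb, smul_smul]
  · refine ⟨w 0, Submodule.mem_span_singleton_self _, ?_⟩
    rw [eq_top_iff]
    intro x _
    have hx : x ∈ Submodule.span k (Set.range w) := w.span_eq ▸ Submodule.mem_top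
    induction hx using Submodule.span_induction with
    | zero => exact zero_mem _
    | add x y _ _ hx hy => exact add_mem (hx trivial) (hy trivial)
    | smul c x _ hx => exact Submodule.smul_of_tower_mem _ c (hx trivial)
    | mem x hx =>
      obtain ⟨d, rfl⟩ := hx
      exact Submodule.mem_span_singleton.2 (hgen d)
  · exact fun d => ⟨Submodule.mem_span_singleton_self _, w.ne_zero d⟩
  · intro d a
    refine Subtype.ext ?_
    rw [hact, hw, hφ, Submodule.coe_smul, hw]

end PointModuleTheory

/-! ### Point sequences and their initial vectors. -/

section PointSequences

variable {k : Type*} [Field k] {n : ℕ}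

/-- The sequences of vectors `P d` describing the action of the generators on the homogeneous
components of a point module of the quantum polynomial ring killed by the Fermat element, namely
`m d · x i = P d i • m (d + 1)`. -/
structure IsPointSeq (q : Fin n → Fin n → k) (P : ℕ → Fin n → k) : Prop where
  ne_zero : ∀ d, ∃ i, P d i ≠ 0
  comm : ∀ d i j, P d j * P (d + 1) i = q j i * (P d i * P (d + 1) j)
  fermat : ∀ d, ∑ i, ∏ t ∈ Finset.range n, P (d + t) i = 0

namespace IsPointSeq

variable {q : Fin n → Fin n → k} {P P' : ℕ → Fin n → k}

/-- If `P (d + 1) j` vanished while `P d j` does not, the commutation rule would kill every entry of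
`P (d + 1)`. -/
theorem succ_ne_zero (hP : IsPointSeq q P) {d : ℕ} {j : Fin n} (hj : P d j ≠ 0) :
    P (d + 1) j ≠ 0 := by
  intro h
  obtain ⟨i, hi⟩ := hP.ne_zero (d + 1)
  have := hP.comm d i j
  rw [h, mul_zero, mul_zero] at this
  exact mul_ne_zero hj hi this

theorem ne_zero_of_zero (hP : IsPointSeq q P) {j : Fin n} (hj : P 0 j ≠ 0) (d : ℕ) :
    P d j ≠ 0 := by
  induction d with
  | zero => exact hj
  | succ d ih => exact hP.succ_ne_zero ih

/-- A point sequence is determined, up to rescaling, by its initial vector. -/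
theorem proportional (hP : IsPointSeq q P) (hP' : IsPointSeq q P') {c : k} (hc : c ≠ 0)
    (h : ∀ i, P' 0 i = c * P 0 i) :
    ∃ c' : ℕ → k, (∀ d, c' d ≠ 0) ∧ ∀ d i, P' d i = c' d * P d i := by
  suffices H : ∀ d, ∃ c' : k, c' ≠ 0 ∧ ∀ i, P' d i = c' * P d i by
    choose c' h1 h2 using H
    exact ⟨c', h1, h2⟩
  intro d
  induction d with
  | zero => exact ⟨c, hc, h⟩
  | succ d ih =>
    obtain ⟨b, hb, ih⟩ := ih
    obtain ⟨j, hj⟩ := hP.ne_zero d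
    have hj1 := hP.succ_ne_zero hj
    have hj' : P' d j ≠ 0 := by rw [ih]; exact mul_ne_zero hb hj
    have hj1' := hP'.succ_ne_zero hj'
    -- The commutation rule with the index `j` fixed expresses the ratio of entries `i` and `j` in
    -- degree `d + 1` through the ratio in degree `d`, so the ratios of `P` and `P'` agree.
    refine ⟨P' (d + 1) j / P (d + 1) j, div_ne_zero hj1' hj1, fun i => ?_⟩
    have h1 := hP.comm d i j
    have h2 := hP'.comm d i j
    rw [ih, ih] at h2
    have h3 : P d j * P' (d + 1) i = q j i * (P d i * P' (d + 1) j) := by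
      apply mul_left_cancel₀ hb
      linear_combination h2
    rw [div_mul_eq_mul_div, eq_div_iff hj1]
    apply mul_left_cancel₀ hj
    linear_combination P (d + 1) j * h3 - P' (d + 1) j * h1

/-- Multiply the commutation rules for the pairs `(i, j)`, `(j, l)`, `(l, i)`: both sides contain
the same product of six nonzero entries. -/
theorem triple_eq_one (hP : IsPointSeq q P) {i j l : Fin n}
    (hi : P 0 i ≠ 0) (hj : P 0 j ≠ 0) (hl : P 0 l ≠ 0) : q i j * q j l * q l i = 1 := by
  have hi' := hP.succ_ne_zero hi
  have hj' := hP.succ_ne_zero hj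
  have hl' := hP.succ_ne_zero hl
  have h1 := hP.comm 0 j i
  have h2 := hP.comm 0 l j
  have h3 := hP.comm 0 i l
  have hne : P 0 i * P 1 i * (P 0 j * P 1 j) * (P 0 l * P 1 l) ≠ 0 := by
    simp only [zero_add] at hi' hj' hl'
    exact mul_ne_zero (mul_ne_zero (mul_ne_zero hi hi') (mul_ne_zero hj hj')) (mul_ne_zero hl hl')
  simp only [zero_add] at h1 h2 h3
  apply mul_right_cancel₀ hne
  calc q i j * q j l * q l i * (P 0 i * P 1 i * (P 0 j * P 1 j) * (P 0 l * P 1 l))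
      = (q i j * (P 0 j * P 1 i)) * (q j l * (P 0 l * P 1 j)) * (q l i * (P 0 i * P 1 l)) := by
        ring
    _ = _ := by rw [← h1, ← h2, ← h3]; ring

/-- Each step multiplies the ratio of the entries `i` and `s` by `q s i`; the identity is written
without denominators. -/
theorem mul_zero_eq (hP : IsPointSeq q P) {s : Fin n} (hs : P 0 s ≠ 0) (d : ℕ) (i : Fin n) :
    P d i * P 0 s = q s i ^ d * P 0 i * P d s := by
  induction d with
  | zero => ring
  | succ d ih =>
    apply mul_left_cancel₀ (hP.ne_zero_of_zero hs d)
    linear_combination P 0 s * hP.comm d i s + q s i * P (d + 1) s * ih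

/-- Substituting `mul_zero_eq` into the Fermat equation in degree `0` turns it into an equation on
`P 0` alone; the exponent is `0 + 1 + ⋯ + (n - 1)`. -/
theorem sum_pow_eq_zero (hP : IsPointSeq q P) {s : Fin n} (hs : P 0 s ≠ 0) :
    ∑ i, q s i ^ (n * (n - 1) / 2) * P 0 i ^ n = 0 := by
  have hterm : ∀ i, (∏ t ∈ Finset.range n, P t i) * P 0 s ^ n =
      q s i ^ (n * (n - 1) / 2) * P 0 i ^ n * ∏ t ∈ Finset.range n, P t s := by
    intro i
    have h := Finset.prod_congr rfl fun t (_ : t ∈ Finset.range n) => hP.mul_zero_eq hs t i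
    rw [Finset.prod_mul_distrib, Finset.prod_mul_distrib, Finset.prod_mul_distrib,
      Finset.prod_pow_eq_pow_sum, Finset.sum_range_id] at h
    simpa only [Finset.prod_const, Finset.card_range] using h
  have hf := hP.fermat 0
  simp only [zero_add] at hf
  have hne : ∏ t ∈ Finset.range n, P t s ≠ 0 :=
    Finset.prod_ne_zero_iff.2 fun t _ => hP.ne_zero_of_zero hs t
  apply mul_right_cancel₀ hne
  rw [Finset.sum_mul, ← Finset.sum_congr rfl fun i _ => hterm i, ← Finset.sum_mul, hf, zero_mul,
    zero_mul]

end IsPointSeq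

/-! ### Consequences of the Calabi–Yau condition for triples of parameters. -/

section Parameters

theorem IsQuantumParameter.ne_zero {q : Fin n → Fin n → k} (hq : IsQuantumParameter q)
    (i j : Fin n) : q i j ≠ 0 := left_ne_zero_of_mul_eq_one (hq.mul_swap i j)

/-- In three variables the Calabi–Yau condition makes the parameters special. -/
theorem IsCalabiYauParameter.isSpecial {q : Fin 3 → Fin 3 → k} (hq : IsQuantumParameter q)
    (h : IsCalabiYauParameter q) (i j : Fin 3) : q j i * q 0 j = q 0 i := by
  have h0 := hq.diag 0
  have h1 := hq.diag 1
  have h2 := hq.diag 2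
  have a := h 0 1
  have b := h 1 2
  simp only [Fin.prod_univ_three, h0, h1, h2, one_mul, mul_one] at a b
  have s01 := hq.mul_swap 0 1
  have s12 := hq.mul_swap 1 2
  have s02 := hq.mul_swap 0 2
  have p01 := hq.pow_eq_one 0 1
  have n01 := hq.ne_zero 0 1
  -- Equality of the products over columns `0` and `1` gives `q 1 2 = q 0 2 * q 0 1 ^ 2`; then `q 0
  -- 1 ^ 3 = 1` finishes.
  have key : q 0 1 * q 1 2 = q 0 2 := by
    have e1 : q 2 0 = q 0 1 ^ 2 * q 2 1 := by linear_combination q 0 1 * a - q 2 0 * s01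
    have e2 : q 2 0 * q 1 2 = q 0 1 ^ 2 := by rw [e1]; linear_combination q 0 1 ^ 2 * s12
    have e3 : q 1 2 = q 0 2 * q 0 1 ^ 2 := by linear_combination q 0 2 * e2 - q 1 2 * s02
    rw [e3]; linear_combination q 0 2 * p01
  have s21 : q 2 1 * q 0 2 = q 0 1 := by rw [← key]; linear_combination q 0 1 * s12
  fin_cases i <;> fin_cases j <;> simp only [Fin.zero_eta, Fin.mk_one, Fin.reduceFinMk, h0, h1, h2,
    one_mul, mul_one]
  · linear_combination s01
  · linear_combination s02
  · exact s21
  · linear_combination key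

/-- In four variables, general Calabi–Yau parameters have no special triples. -/
theorem IsCalabiYauParameter.triple_ne_one {q : Fin 4 → Fin 4 → k} (hq : IsQuantumParameter q)
    (h : IsCalabiYauParameter q) (hgen : IsGeneralParameter q) {i j l : Fin 4} (hij : i ≠ j)
    (hjl : j ≠ l) (hli : l ≠ i) : q i j * q j l * q l i ≠ 1 := by
  intro h1
  -- The constant factor contributes `q i j ^ 4 = 1`. The Calabi–Yau condition replaces column `i`
  -- by column `j`, whose entries cancel against row `j`.
  have hprod : ∀ i j, ∏ l, (q i j * q j l * q l i) = 1 := by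
    intro i j
    rw [Finset.prod_mul_distrib, Finset.prod_mul_distrib, Finset.prod_const, h i j,
      Finset.card_univ, Fintype.card_fin, hq.pow_eq_one, one_mul, ← Finset.prod_mul_distrib]
    exact Finset.prod_eq_one fun l _ => by rw [hq.mul_swap]
  have hrot : ∀ i j l, q i j * q j l * q l i = q j l * q l i * q i j := by intros; ring
  have hdeg : ∀ i j, q i j * q j i * q i i = 1 := by
    intro i j; rw [hq.mul_swap, hq.diag, one_mul]
  have hdeg' : ∀ i j, q i j * q j j * q j i = 1 := by
    intro i j; rw [hq.diag, mul_one, hq.mul_swap]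
  have hswap : ∀ i j l, q i j * q j l * q l i = 1 → q j i * q i l * q l j = 1 := by
    intro i j l h
    have e : (q i j * q j l * q l i) * (q j i * q i l * q l j) = 1 := by
      calc _ = (q i j * q j i) * (q j l * q l j) * (q l i * q i l) := by ring
        _ = 1 := by simp only [hq.mul_swap, mul_one]
    rwa [h, one_mul] at e
  -- In `hprod` the factors at `i` and `j` are trivial, so the triples completing the pair `i, j` by
  -- the two remaining indices are mutually inverse: if one is `1`, so is the other.
  have hnext : ∀ i j l, i ≠ j → j ≠ l → l ≠ i → q i j * q j l * q l i = 1 →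
      ∀ m, q i j * q j m * q m i = 1 := by
    intro i j l h1 h2 h3 h m
    rcases eq_or_ne m i with rfl | h4
    · exact hdeg m j
    rcases eq_or_ne m j with rfl | h5
    · exact hdeg' i m
    rcases eq_or_ne m l with rfl | h6
    · exact h
    have huniv : (Finset.univ : Finset (Fin 4)) = {i, j, l, m} := by
      symm
      rw [Finset.eq_univ_iff_forall]
      intro x
      simp only [Finset.mem_insert, Finset.mem_singleton]
      lia
    have hp := hprod i j
    rw [huniv, Finset.prod_insert (by simp; tauto), Finset.prod_insert (by simp; tauto),
      Finset.prod_insert (by simp; tauto), Finset.prod_singleton, hdeg, hdeg', h] at hp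
    simpa using hp
  -- Triviality spreads from the pair `i, j` to all triples through `i`, and from those, by one more
  -- use of `hnext`, to all triples.
  have hi : ∀ x y, q i x * q x y * q y i = 1 := by
    intro x y
    rcases eq_or_ne x i with rfl | h2
    · rw [hq.diag, one_mul, hq.mul_swap]
    rcases eq_or_ne x j with rfl | h3
    · exact hnext _ _ _ hij hjl hli h1 y
    refine hnext i x j h2.symm h3 hij.symm ?_ y
    have := hswap _ _ _ (hnext _ _ _ hij hjl hli h1 x)
    rwa [hrot] at this
  refine hgen fun x y z => ?_
  rcases eq_or_ne x y with rfl | h2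
  · rw [hq.diag, one_mul, hq.mul_swap]
  rcases eq_or_ne x i with rfl | h3
  · exact hi y z
  rcases eq_or_ne y i with rfl | h4
  · exact hswap _ _ _ (hi x z)
  exact hnext x y i h2 h4 h3.symm (by rw [← hrot]; exact hi x y) z

end Parameters

/-- The sequence `d ↦ (t i ^ d * r i)ᵢ`. -/
def twistedSeq (t r : Fin n → k) (d : ℕ) (i : Fin n) : k := t i ^ d * r i

@[simp]
theorem twistedSeq_zero (t r : Fin n → k) : twistedSeq t r 0 = r := by
  funext i
  simp [twistedSeq]

/-- The commutation rule needs `q` to be of the form `t i / t j` only on the support of `r`. In the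
Fermat equation the shift by `d` contributes `(t i ^ n) ^ d = 1`, so a single equation on `r`
suffices. -/
theorem isPointSeq_twistedSeq {q : Fin n → Fin n → k} {t r : Fin n → k} (hr : ∃ i, r i ≠ 0)
    (ht : ∀ i, t i ^ n = 1) (htq : ∀ i j, r i ≠ 0 → r j ≠ 0 → q j i * t j = t i)
    (hsum : ∑ i, t i ^ (n * (n - 1) / 2) * r i ^ n = 0) : IsPointSeq q (twistedSeq t r) where
  ne_zero d := by
    obtain ⟨i, hi⟩ := hr
    refine ⟨i, mul_ne_zero (pow_ne_zero d ?_) hi⟩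
    have hn : n ≠ 0 := by
      rintro rfl
      exact i.elim0
    intro h
    have := ht i
    rw [h, zero_pow hn] at this
    exact zero_ne_one this
  comm d i j := by
    simp only [twistedSeq]
    by_cases hi : r i = 0
    · simp [hi]
    by_cases hj : r j = 0
    · simp [hj]
    rw [pow_succ (t i), ← htq i j hi hj]
    ring
  fermat d := by
    rw [← hsum]
    refine Finset.sum_congr rfl fun i _ => ?_
    simp only [twistedSeq, Finset.prod_mul_distrib, Finset.prod_const, Finset.card_range, pow_add]
    rw [Finset.prod_pow_eq_pow_sum, Finset.sum_range_id, ← pow_mul, mul_comm d n, pow_mul, ht,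
      one_pow, one_mul]

theorem isPointSeq_twistedSeq_three {q : Fin 3 → Fin 3 → k} (hq : IsQuantumParameter q)
    (h : IsCalabiYauParameter q) {r : Fin 3 → k} (hr : ∃ i, r i ≠ 0) (hsum : ∑ i, r i ^ 3 = 0) :
    IsPointSeq q (twistedSeq (q 0) r) := by
  refine isPointSeq_twistedSeq hr (hq.pow_eq_one 0) (fun i j _ _ => h.isSpecial hq i j) ?_
  rw [← hsum]
  refine Finset.sum_congr rfl fun i _ => ?_
  rw [show 3 * (3 - 1) / 2 = 3 from rfl, hq.pow_eq_one, one_mul]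

theorem IsPointSeq.sum_pow_three {q : Fin 3 → Fin 3 → k} (hq : IsQuantumParameter q)
    {R : ℕ → Fin 3 → k} (hR : IsPointSeq q R) : ∑ i, R 0 i ^ 3 = 0 := by
  obtain ⟨j, hj⟩ := hR.ne_zero 0
  rw [← hR.sum_pow_eq_zero hj]
  refine Finset.sum_congr rfl fun i _ => ?_
  rw [show 3 * (3 - 1) / 2 = 3 from rfl, hq.pow_eq_one, one_mul]

/-- Vectors with two nonzero coordinates, one of them `1` and the other an eighth root of unity. -/
def edgeVectors (k : Type*) [Field k] : Set (Fin 4 → k) :=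
  {v | ∃ (i j : Fin 4) (c : k), c ^ 8 = 1 ∧ v = Pi.single i 1 + Pi.single j c}

theorem finite_edgeVectors : (edgeVectors k).Finite := by
  classical
  have hfin : {c : k | c ^ 8 = 1}.Finite := by
    refine (Polynomial.nthRoots 8 (1 : k)).toFinset.finite_toSet.subset fun c hc => ?_
    simpa [Polynomial.mem_nthRoots] using hc
  refine ((Set.finite_univ (α := Fin 4 × Fin 4)).prod hfin |>.image fun x =>
    (Pi.single x.1.1 1 + Pi.single x.1.2 x.2 : Fin 4 → k)).subset ?_
  rintro v ⟨i, j, c, hc, rfl⟩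
  exact ⟨((i, j), c), ⟨trivial, hc⟩, rfl⟩

theorem IsPointSeq.exists_edgeVector {q : Fin 4 → Fin 4 → k} (hq : IsQuantumParameter q)
    (h : IsCalabiYauParameter q) (hgen : IsGeneralParameter q) {P : ℕ → Fin 4 → k}
    (hP : IsPointSeq q P) : ∃ v ∈ edgeVectors k, ∃ c : k, c ≠ 0 ∧ ∀ i, P 0 i = c * v i := by
  obtain ⟨s, hs⟩ := hP.ne_zero 0
  have hsum := hP.sum_pow_eq_zero hs
  rw [show 4 * (4 - 1) / 2 = 6 from rfl, ← Finset.add_sum_erase _ _ (Finset.mem_univ s), hq.diag,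
    one_pow, one_mul] at hsum
  obtain ⟨j, hj, hj0⟩ : ∃ j ∈ Finset.univ.erase s, q s j ^ 6 * P 0 j ^ 4 ≠ 0 := by
    apply Finset.exists_ne_zero_of_sum_ne_zero
    intro h0
    rw [h0, add_zero] at hsum
    exact pow_ne_zero 4 hs hsum
  have hjs : j ≠ s := Finset.ne_of_mem_erase hj
  have hj0 : P 0 j ≠ 0 := by
    intro h0
    simp [h0] at hj0
  -- A third nonzero coordinate would produce a trivial triple of distinct indices.
  have hzero : ∀ l, l ≠ s → l ≠ j → P 0 l = 0 := fun l hls hlj => by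
    by_contra hl
    exact h.triple_ne_one hq hgen hjs.symm hlj.symm hls (hP.triple_eq_one hs hj0 hl)
  rw [Finset.sum_eq_single_of_mem j hj fun l hl hlj => by
    rw [hzero l (Finset.ne_of_mem_erase hl) hlj]; ring] at hsum
  refine ⟨Pi.single s 1 + Pi.single j (P 0 j / P 0 s), ⟨s, j, _, ?_, rfl⟩, P 0 s, hs, fun i => ?_⟩
  -- The Fermat equation reads `P 0 s ^ 4 + q s j ^ 6 * P 0 j ^ 4 = 0`; squaring removes the sign
  -- and leaves `q s j ^ 12`, which is `1`.
  · have h12 : q s j ^ 12 = 1 := by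
      rw [show 12 = 4 * 3 from rfl, pow_mul, hq.pow_eq_one, one_pow]
    rw [div_pow, div_eq_one_iff_eq (pow_ne_zero 8 hs)]
    linear_combination (q s j ^ 6 * P 0 j ^ 4 - P 0 s ^ 4) * hsum - P 0 j ^ 8 * h12
  · by_cases hi : i = s
    · subst hi
      simp [hjs.symm]
    · by_cases hi' : i = j
      · subst hi'
        simp [hjs, mul_div_cancel₀ _ hs]
      · simp [hi, hi', hzero i hi hi']

theorem exists_isPointSeq_four [IsAlgClosed k] {q : Fin 4 → Fin 4 → k}
    (hq : IsQuantumParameter q) : ∃ P, IsPointSeq q P := by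
  -- This choice solves `1 + q 0 1 ^ 6 * c ^ 4 = 0`, since `q 0 1 ^ 8 = 1`. The resulting sequence
  -- ensures that the moduli space is nonempty.
  obtain ⟨c, hc⟩ : ∃ c : k, c ^ 4 = -q 0 1 ^ 2 := IsAlgClosed.exists_pow_nat_eq _ (by norm_num)
  have h8 : q 0 1 ^ 8 = 1 := by
    rw [show 8 = 4 * 2 from rfl, pow_mul, hq.pow_eq_one, one_pow]
  refine ⟨_, isPointSeq_twistedSeq (t := q 0) (r := ![1, c, 0, 0]) ⟨0, by simp⟩ (hq.pow_eq_one 0)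
    ?_ ?_⟩
  · have h1 := hq.mul_swap 1 0
    have h2 := hq.diag 0
    have h3 := hq.diag 1
    intro i j hi hj
    fin_cases i <;> fin_cases j <;> simp_all
  · simp only [Fin.sum_univ_four, show 4 * (4 - 1) / 2 = 6 from rfl, hq.diag]
    simp
    linear_combination q 0 1 ^ 6 * hc - h8

end PointSequences

/-! ### Moduli spaces parametrized by pairs of point sequences. -/

section Parametrization

universe u v w

variable {k : Type u} [Field k] {C : Type v} [Ring C] [Algebra k C]
  {ι : Type w} [AddMonoid ι] [DecidableEq ι]

/-- A parametrization of the point modules of a graded algebra by pairs of point sequences. -/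
structure PointParametrization {n m : ℕ} (q : Fin n → Fin n → k) (q' : Fin m → Fin m → k)
    (𝒞 : ι → Submodule k C) where
  /-- the coordinates of the point module attached to a pair of point sequences -/
  coord : {P // IsPointSeq q P} → {R // IsPointSeq q' R} → (Σ d, 𝒞 d) → k
  exists_isCoord : ∀ P R, ∃ M : PointModule 𝒞, M.IsCoord (coord P R)
  isCoord : ∀ M : PointModule 𝒞, ∃ P R, M.IsCoord (coord P R)
  scale : ∀ (P P' : {P // IsPointSeq q P}) (R R' : {R // IsPointSeq q' R}) (c c' : ℕ → k),
    (∀ d, c d ≠ 0) → (∀ d, c' d ≠ 0) → (∀ d i, P'.1 d i = c d * P.1 d i) →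
    (∀ d i, R'.1 d i = c' d * R.1 d i) →
    ∃ b : ι → k, (∀ d, b d ≠ 0) ∧ b 0 = 1 ∧ ∀ s, coord P' R' s = b s.1 * coord P R s
  /-- the elements corresponding to products of two generators -/
  elem : ∃ (D : ι) (a : Fin n → Fin m → 𝒞 D),
    ∀ P R i j, coord P R ⟨D, a i j⟩ = P.1 0 i * R.1 0 j
  -- This pulls conditions on coordinates back to polynomial equations in `r`, with `P` and the
  -- twist `t` fixed.
  poly : ∀ P (t : Fin m → k) (s : Σ d, 𝒞 d), ∃ G : MvPolynomial (Fin m) k, ∀ R r,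
    R.1 = twistedSeq t r → coord P R s = MvPolynomial.eval r G

namespace PointParametrization

section General

variable {n m : ℕ} {q : Fin n → Fin n → k} {q' : Fin m → Fin m → k} {𝒞 : ι → Submodule k C}
  (T : PointParametrization q q' 𝒞)

/-- The point of the moduli space attached to a pair of point sequences. -/
def point (P : {P // IsPointSeq q P}) (R : {R // IsPointSeq q' R}) : PointModuli 𝒞 :=
  Quotient.mk _ (T.exists_isCoord P R).choose

theorem point_mem_basicOpen (P : {P // IsPointSeq q P}) (R : {R // IsPointSeq q' R})
    {p : MvPolynomial (Σ d, 𝒞 d) k} (hp : IsMultihomogeneous p) :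
    T.point P R ∈ PointModuli.basicOpen 𝒞 p ↔ MvPolynomial.eval (T.coord P R) p ≠ 0 :=
  (T.exists_isCoord P R).choose_spec.mem_basicOpen hp

theorem mk_eq_point (hC : ⨆ d, 𝒞 d = ⊤) {M : PointModule 𝒞} {P : {P // IsPointSeq q P}}
    {R : {R // IsPointSeq q' R}} (h : M.IsCoord (T.coord P R)) :
    (Quotient.mk _ M : PointModuli 𝒞) = T.point P R :=
  Quotient.sound (h.iso hC (T.exists_isCoord P R).choose_spec)

theorem exists_eq_point (hC : ⨆ d, 𝒞 d = ⊤) (z : PointModuli 𝒞) : ∃ P R, z = T.point P R := by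
  obtain ⟨M, rfl⟩ := Quotient.exists_rep z
  obtain ⟨P, R, h⟩ := T.isCoord M
  exact ⟨P, R, T.mk_eq_point hC h⟩

theorem point_eq_point (hC : ⨆ d, 𝒞 d = ⊤) {P P' : {P // IsPointSeq q P}}
    {R R' : {R // IsPointSeq q' R}} {c c' : k} (hc : c ≠ 0) (hc' : c' ≠ 0)
    (hP : ∀ i, P'.1 0 i = c * P.1 0 i) (hR : ∀ i, R'.1 0 i = c' * R.1 0 i) :
    T.point P' R' = T.point P R := by
  obtain ⟨b, hb, hbP⟩ := P.2.proportional P'.2 hc hP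
  obtain ⟨b', hb', hbR⟩ := R.2.proportional R'.2 hc' hR
  obtain ⟨e, he, he0, h⟩ := T.scale P P' R R' b b' hb hb' hbP hbR
  exact (T.mk_eq_point hC ((T.exists_isCoord P R).choose_spec.rescale e he he0 h)).symm

/-- The products `P 0 i * R 0 j` are themselves coordinates in one degree, so the class of the
module determines the Segre image of the initial vectors. -/
theorem exists_scale_of_point_eq {P P' : {P // IsPointSeq q P}} {R R' : {R // IsPointSeq q' R}}
    (h : T.point P R = T.point P' R') :
    ∃ c : k, ∀ i j, P'.1 0 i * R'.1 0 j = c * (P.1 0 i * R.1 0 j) := by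
  obtain ⟨c, -, hc⟩ := (T.exists_isCoord P R).choose_spec.exists_scale
    (T.exists_isCoord P' R').choose_spec (Quotient.exact h)
  obtain ⟨D, a, ha⟩ := T.elem
  exact ⟨c D, fun i j => by rw [← ha, ← ha, hc]⟩

theorem exists_eq_smul_of_cross_mul {l : ℕ} {v p : Fin l → k} (hv : ∃ i, v i ≠ 0)
    (hp : ∃ i, p i ≠ 0) (h : ∀ i i', v i' * p i = v i * p i') :
    ∃ c : k, c ≠ 0 ∧ ∀ i, p i = c * v i := by
  obtain ⟨j, hj⟩ := hv
  have hc : ∀ i, p i = p j / v j * v i := fun i => by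
    rw [div_mul_eq_mul_div, eq_div_iff hj]
    linear_combination h i j
  refine ⟨p j / v j, fun h0 => ?_, hc⟩
  obtain ⟨i, hi⟩ := hp
  exact hi (by rw [hc, h0, zero_mul])

/-- Proportionality of `P 0` and `v` is the vanishing of the two-by-two minors. Multiplied by `R 0
j` they become linear in the coordinates of degree `D`, and nothing is lost because some `R 0 j` is
nonzero. -/
theorem isClosed_setOf_fst (hC : ⨆ d, 𝒞 d = ⊤) {v : Fin n → k} (hv : ∃ i, v i ≠ 0) :
    IsClosed {z | ∃ P R, z = T.point P R ∧ ∃ c : k, c ≠ 0 ∧ ∀ i, P.1 0 i = c * v i} := by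
  obtain ⟨D, a, ha⟩ := T.elem
  let p : Fin n → Fin n → Fin m → MvPolynomial (Σ d, 𝒞 d) k := fun i i' j =>
    MvPolynomial.C (v i') * MvPolynomial.X ⟨D, a i j⟩ -
      MvPolynomial.C (v i) * MvPolynomial.X ⟨D, a i' j⟩
  have hp : ∀ i i' j, IsMultihomogeneous (p i i' j) := fun i i' j =>
    isMultihomogeneous_sub _ _ _ _ _
  have heval : ∀ P R i i' j, MvPolynomial.eval (T.coord P R) (p i i' j) =
      (v i' * P.1 0 i - v i * P.1 0 i') * R.1 0 j := by
    intro P R i i' j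
    simp only [p, map_sub, map_mul, MvPolynomial.eval_C, MvPolynomial.eval_X, ha]
    ring
  convert isClosed_iInter fun i => isClosed_iInter fun i' => isClosed_iInter fun j =>
    (PointModuli.isOpen_basicOpen (hp i i' j)).isClosed_compl using 1
  ext z
  simp only [Set.mem_ofPred_eq, Set.mem_iInter, Set.mem_compl_iff]
  constructor
  · rintro ⟨P, R, rfl, c, -, h⟩ i i' j
    rw [T.point_mem_basicOpen _ _ (hp i i' j), heval, h, h]
    ring_nf
    simp
  · intro hz
    obtain ⟨P, R, rfl⟩ := T.exists_eq_point hC z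
    refine ⟨P, R, rfl, exists_eq_smul_of_cross_mul hv (P.2.ne_zero 0) fun i i' => ?_⟩
    obtain ⟨j, hj⟩ := R.2.ne_zero 0
    have := hz i i' j
    rw [T.point_mem_basicOpen _ _ (hp i i' j), heval, not_not, mul_eq_zero, or_iff_left hj,
      sub_eq_zero] at this
    exact this

theorem isClosed_setOf_snd (hC : ⨆ d, 𝒞 d = ⊤) {v : Fin m → k} (hv : ∃ i, v i ≠ 0) :
    IsClosed {z | ∃ P R, z = T.point P R ∧ ∃ c : k, c ≠ 0 ∧ ∀ i, R.1 0 i = c * v i} := by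
  obtain ⟨D, a, ha⟩ := T.elem
  let p : Fin m → Fin m → Fin n → MvPolynomial (Σ d, 𝒞 d) k := fun i i' j =>
    MvPolynomial.C (v i') * MvPolynomial.X ⟨D, a j i⟩ -
      MvPolynomial.C (v i) * MvPolynomial.X ⟨D, a j i'⟩
  have hp : ∀ i i' j, IsMultihomogeneous (p i i' j) := fun i i' j =>
    isMultihomogeneous_sub _ _ _ _ _
  have heval : ∀ P R i i' j, MvPolynomial.eval (T.coord P R) (p i i' j) =
      (v i' * R.1 0 i - v i * R.1 0 i') * P.1 0 j := by
    intro P R i i' j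
    simp only [p, map_sub, map_mul, MvPolynomial.eval_C, MvPolynomial.eval_X, ha]
    ring
  convert isClosed_iInter fun i => isClosed_iInter fun i' => isClosed_iInter fun j =>
    (PointModuli.isOpen_basicOpen (hp i i' j)).isClosed_compl using 1
  ext z
  simp only [Set.mem_ofPred_eq, Set.mem_iInter, Set.mem_compl_iff]
  constructor
  · rintro ⟨P, R, rfl, c, -, h⟩ i i' j
    rw [T.point_mem_basicOpen _ _ (hp i i' j), heval, h, h]
    ring_nf
    simp
  · intro hz
    obtain ⟨P, R, rfl⟩ := T.exists_eq_point hC z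
    refine ⟨P, R, rfl, exists_eq_smul_of_cross_mul hv (R.2.ne_zero 0) fun i i' => ?_⟩
    obtain ⟨j, hj⟩ := P.2.ne_zero 0
    have := hz i i' j
    rw [T.point_mem_basicOpen _ _ (hp i i' j), heval, not_not, mul_eq_zero, or_iff_left hj,
      sub_eq_zero] at this
    exact this

theorem isClosed_singleton (T : PointParametrization q q' 𝒞) (hC : ⨆ d, 𝒞 d = ⊤)
    (z : PointModuli 𝒞) : IsClosed {z} := by
  obtain ⟨P, R, rfl⟩ := T.exists_eq_point hC z
  convert (T.isClosed_setOf_fst hC (P.2.ne_zero 0)).inter (T.isClosed_setOf_snd hC (R.2.ne_zero 0))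
    using 1
  ext z
  simp only [Set.mem_singleton_iff, Set.mem_inter_iff, Set.mem_ofPred_eq]
  constructor
  · rintro rfl
    exact ⟨⟨P, R, rfl, 1, one_ne_zero, by simp⟩, ⟨P, R, rfl, 1, one_ne_zero, by simp⟩⟩
  · rintro ⟨⟨P', R', rfl, c, hc, hP⟩, ⟨P'', R'', h, c', hc', hR⟩⟩
    -- The two conditions may be witnessed by different pairs representing the same point. Comparing
    -- Segre coordinates shows that `R'`, not only `R''`, starts with a multiple of `R 0`.
    obtain ⟨b, hb⟩ := T.exists_scale_of_point_eq h
    obtain ⟨i, hi⟩ := P'.2.ne_zero 0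
    obtain ⟨i', hi'⟩ := P''.2.ne_zero 0
    have hb0 : b ≠ 0 := by
      rintro rfl
      obtain ⟨j, hj⟩ := R''.2.ne_zero 0
      exact mul_ne_zero hi' hj (by rw [hb, zero_mul])
    have h' : ∀ j j', R.1 0 j' * R'.1 0 j = R.1 0 j * R'.1 0 j' := by
      intro j j'
      have h1 := hb i' j
      have h2 := hb i' j'
      rw [hR] at h1 h2
      have hi0 : P'.1 0 i' ≠ 0 := by
        intro h0
        obtain ⟨j, hj⟩ := R''.2.ne_zero 0
        exact mul_ne_zero hi' hj (by rw [hb, h0, zero_mul, mul_zero])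
      apply mul_left_cancel₀ (mul_ne_zero hb0 hi0)
      linear_combination R.1 0 j * h2 - R.1 0 j' * h1
    obtain ⟨e, he, hR'⟩ := exists_eq_smul_of_cross_mul (R.2.ne_zero 0) (R'.2.ne_zero 0) h'
    exact T.point_eq_point hC hc he hP hR'

end General

section Dimension

variable {q : Fin 4 → Fin 4 → k} {q' : Fin 3 → Fin 3 → k}
  {𝒞 : ι → Submodule k C}

/-- The point sequence of `q'` attached to a point of the Fermat cubic. -/
def cubicSeq (hq' : IsQuantumParameter q') (hCY' : IsCalabiYauParameter q') {i : Fin 3}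
    {r : Fin 3 → k} (hr : r ∈ fermatCubicChart k i) : {R // IsPointSeq q' R} :=
  ⟨twistedSeq (q' 0) r, isPointSeq_twistedSeq_three hq' hCY' ⟨i, by simp [hr.1]⟩ hr.2⟩

theorem exists_cubicSeq (hq' : IsQuantumParameter q') (hCY' : IsCalabiYauParameter q')
    (R : {R // IsPointSeq q' R}) {i : Fin 3} (hi : R.1 0 i ≠ 0) :
    ∃ (r : Fin 3 → k) (hr : r ∈ fermatCubicChart k i), ∃ c : k, c ≠ 0 ∧
      ∀ j, R.1 0 j = c * (cubicSeq hq' hCY' hr).1 0 j := by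
  refine ⟨fun j => R.1 0 j / R.1 0 i, ⟨div_self hi, ?_⟩, R.1 0 i, hi, fun j => ?_⟩
  · simp only [div_pow, ← Finset.sum_div, R.2.sum_pow_three hq', zero_div]
  · simp [cubicSeq, mul_div_cancel₀ _ hi]

/-- One polynomial `G` serves all three charts, which later allows vanishing to be carried from one
chart to another. -/
theorem exists_eval_coord_eq (T : PointParametrization q q' 𝒞) (hq' : IsQuantumParameter q')
    (hCY' : IsCalabiYauParameter q') (P : {P // IsPointSeq q P})
    (p : MvPolynomial (Σ d, 𝒞 d) k) : ∃ G : MvPolynomial (Fin 3) k,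
      ∀ (i : Fin 3) (r : Fin 3 → k) (hr : r ∈ fermatCubicChart k i),
        MvPolynomial.eval (T.coord P (cubicSeq hq' hCY' hr)) p = MvPolynomial.eval r G := by
  choose g hg using T.poly P (q' 0)
  refine ⟨MvPolynomial.bind₁ g p, fun i r hr => ?_⟩
  have h : T.coord P (cubicSeq hq' hCY' hr) = fun s => MvPolynomial.eval r (g s) :=
    funext fun s => hg s _ r rfl
  rw [h, ← MvPolynomial.coe_aeval_eq_eval, ← MvPolynomial.coe_aeval_eq_eval, RingHom.coe_coe,
    RingHom.coe_coe, MvPolynomial.aeval_bind₁]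

/-- The curve of points whose first sequence starts with a multiple of `v`. -/
def curve (T : PointParametrization q q' 𝒞) (v : Fin 4 → k) : Set (PointModuli 𝒞) :=
  {z | ∃ P R, z = T.point P R ∧ ∃ c : k, c ≠ 0 ∧ ∀ i, P.1 0 i = c * v i}

theorem mem_curve_iff (T : PointParametrization q q' 𝒞) (hC : ⨆ d, 𝒞 d = ⊤)
    (hq' : IsQuantumParameter q')
    (hCY' : IsCalabiYauParameter q') {v : Fin 4 → k} {P : {P // IsPointSeq q P}} {c : k}
    (hc : c ≠ 0) (hv : ∀ i, P.1 0 i = c * v i) {z : PointModuli 𝒞} :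
    z ∈ T.curve v ↔ ∃ (i : Fin 3) (r : Fin 3 → k) (hr : r ∈ fermatCubicChart k i),
      z = T.point P (cubicSeq hq' hCY' hr) := by
  constructor
  · rintro ⟨P', R, rfl, c', hc', h⟩
    obtain ⟨i, hi⟩ := R.2.ne_zero 0
    obtain ⟨r, hr, b, hb, hR⟩ := exists_cubicSeq hq' hCY' R hi
    refine ⟨i, r, hr, T.point_eq_point hC (div_ne_zero hc' hc) hb (fun i => ?_) hR⟩
    rw [h, hv]
    field_simp
  · rintro ⟨i, r, hr, rfl⟩
    exact ⟨P, _, rfl, c, hc, hv⟩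

variable [IsAlgClosed k] [CharZero k]

/-- Points of one chart give distinct modules: equal modules have proportional Segre coordinates,
and the normalized coordinate `0` forces the factor to be `1`. -/
theorem infinite_curve (T : PointParametrization q q' 𝒞) (hq' : IsQuantumParameter q')
    (hCY' : IsCalabiYauParameter q') {v : Fin 4 → k} {P : {P // IsPointSeq q P}} {c : k}
    (hc : c ≠ 0) (hv : ∀ i, P.1 0 i = c * v i) : (T.curve v).Infinite := by
  have : Infinite (fermatCubicChart k 0) := (infinite_fermatCubicChart 0).to_subtype
  refine Set.infinite_of_injective_forall_mem
    (f := fun r : fermatCubicChart k 0 => T.point P (cubicSeq hq' hCY' r.2)) ?_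
    fun r => ⟨P, _, rfl, c, hc, hv⟩
  intro r r' h
  obtain ⟨b, hb⟩ := T.exists_scale_of_point_eq h
  obtain ⟨i, hi⟩ := P.2.ne_zero 0
  simp only [cubicSeq, twistedSeq_zero] at hb
  have h0 := hb i 0
  rw [r.2.1, r'.2.1] at h0
  have hb1 : b = 1 := mul_right_cancel₀ hi (by linear_combination -h0)
  refine Subtype.ext (funext fun j => ?_)
  have := hb i j
  rw [hb1, one_mul] at this
  exact (mul_left_cancel₀ hi this).symm

/-- On each chart the complement of the basic open set is the zero locus of `G`, so it is finite or
everything. The charts overlap in infinitely many points, so if it is everything on one chart it is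
everything on all. -/
theorem finite_sdiff_basicOpen_or_disjoint (T : PointParametrization q q' 𝒞)
    (hC : ⨆ d, 𝒞 d = ⊤) (hq' : IsQuantumParameter q') (hCY' : IsCalabiYauParameter q')
    {v : Fin 4 → k} {P : {P // IsPointSeq q P}} {c : k} (hc : c ≠ 0)
    (hv : ∀ i, P.1 0 i = c * v i) {p : MvPolynomial (Σ d, 𝒞 d) k} (hp : IsMultihomogeneous p) :
    (T.curve v \ PointModuli.basicOpen 𝒞 p).Finite ∨
      Disjoint (T.curve v) (PointModuli.basicOpen 𝒞 p) := by
  classical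
  obtain ⟨G, hG⟩ := T.exists_eval_coord_eq hq' hCY' P p
  have hmem : ∀ {i r} (hr : r ∈ fermatCubicChart k i),
      T.point P (cubicSeq hq' hCY' hr) ∈ PointModuli.basicOpen 𝒞 p ↔ MvPolynomial.eval r G ≠ 0 :=
    fun hr => by rw [T.point_mem_basicOpen _ _ hp, hG]
  by_cases hfin : ∀ i, {r ∈ fermatCubicChart k i | MvPolynomial.eval r G = 0}.Finite
  · left
    have hsub : T.curve v \ PointModuli.basicOpen 𝒞 p ⊆ ⋃ i,
        -- Outside the chart the value is an arbitrary point, present only to make the map total.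
        (fun r => if hr : r ∈ fermatCubicChart k i then T.point P (cubicSeq hq' hCY' hr) else
          T.point P (cubicSeq hq' hCY' (infinite_fermatCubicChart (k := k) 0).nonempty.some_mem)) ''
          {r ∈ fermatCubicChart k i | MvPolynomial.eval r G = 0} := by
      rintro z ⟨hz, hz'⟩
      obtain ⟨i, r, hr, rfl⟩ := (T.mem_curve_iff hC hq' hCY' hc hv).1 hz
      rw [hmem, not_not] at hz'
      exact Set.mem_iUnion.2 ⟨i, r, ⟨hr, hz'⟩, by simp [hr]⟩
    exact (Set.finite_iUnion fun i => (hfin i).image _).subset hsub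
  · right
    push Not at hfin
    obtain ⟨i, hi⟩ := hfin
    have hall := (finite_zeros_or_eq_zero_on_fermatCubicChart G i).resolve_left hi
    have hall' : ∀ j, ∀ r ∈ fermatCubicChart k j, MvPolynomial.eval r G = 0 := by
      intro j
      refine (finite_zeros_or_eq_zero_on_fermatCubicChart G j).resolve_left fun hj => ?_
      refine infinite_fermatCubicChart_ne_zero j i (hj.subset ?_)
      rintro r ⟨hr, hri⟩
      refine ⟨hr, ?_⟩
      by_contra hne
      have hz := (hmem hr).2 hne
      -- Rescaling so that the `i`-th coordinate is `1` moves the point into chart `i`, where `G`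
      -- vanishes, without changing the point of the moduli space.
      obtain ⟨r', hr', b, hb, h⟩ := exists_cubicSeq hq' hCY' (cubicSeq hq' hCY' hr) (i := i)
        (by simpa [cubicSeq] using hri)
      rw [T.point_eq_point hC one_ne_zero hb (fun i => (one_mul _).symm) h, hmem hr'] at hz
      exact hz (hall r' hr')
    rw [Set.disjoint_left]
    intro z hz
    obtain ⟨j, r, hr, rfl⟩ := (T.mem_curve_iff hC hq' hCY' hc hv).1 hz
    rw [hmem, not_not]
    exact hall' j r hr

theorem topologicalKrullDim_eq_one (T : PointParametrization q q' 𝒞) (hC : ⨆ d, 𝒞 d = ⊤)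
    (hq : IsQuantumParameter q) (hq' : IsQuantumParameter q') (hCY : IsCalabiYauParameter q)
    (hCY' : IsCalabiYauParameter q') (hgen : IsGeneralParameter q) :
    topologicalKrullDim (PointModuli 𝒞) = 1 := by
  let F : Set (Fin 4 → k) := {v ∈ edgeVectors k | ∃ P : {P // IsPointSeq q P}, ∃ c : k, c ≠ 0 ∧
    ∀ i, P.1 0 i = c * v i}
  have hF : ∀ P : {P // IsPointSeq q P}, ∃ v ∈ F, ∃ c : k, c ≠ 0 ∧ ∀ i, P.1 0 i = c * v i := by
    intro P
    obtain ⟨v, hv, c, hc, h⟩ := P.2.exists_edgeVector hq hCY hgen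
    exact ⟨v, ⟨hv, P, c, hc, h⟩, c, hc, h⟩
  have hFne : ∀ v ∈ F, ∃ i, v i ≠ 0 := by
    rintro v ⟨-, P, c, -, h⟩
    obtain ⟨i, hi⟩ := P.2.ne_zero 0
    exact ⟨i, fun h0 => hi (by rw [h, h0, mul_zero])⟩
  have : Finite F := (finite_edgeVectors.subset (Set.sep_subset _ _)).to_subtype
  have : Nonempty F := by
    obtain ⟨P, hP⟩ := exists_isPointSeq_four hq
    obtain ⟨v, hv, -⟩ := hF ⟨P, hP⟩
    exact ⟨⟨v, hv⟩⟩
  refine topologicalKrullDim_eq_one_of_cofinite_cover (F := F) (fun v => T.curve v) ?_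
    (T.isClosed_singleton hC) (fun v => T.isClosed_setOf_fst hC (hFne v v.2)) ?_ ?_ ?_
  · intro z
    obtain ⟨P, R, rfl⟩ := T.exists_eq_point hC z
    obtain ⟨v, hv, c, hc, h⟩ := hF P
    exact ⟨⟨v, hv⟩, P, R, rfl, c, hc, h⟩
  · rintro ⟨v, -, P, c, hc, h⟩
    exact T.infinite_curve hq' hCY' hc h
  -- Different vectors of `F` may be proportional and define the same curve. One common point
  -- already makes `v` and `v'` proportional, which gives the reverse inclusion.
  · rintro ⟨v, _, P, c, hc, h⟩ ⟨v', hv'⟩ hsub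
    obtain ⟨r, hr⟩ := (infinite_fermatCubicChart (k := k) 0).nonempty
    obtain ⟨P', R', heq, c', hc', h'⟩ :=
      hsub ⟨P, cubicSeq hq' hCY' hr, rfl, c, hc, h⟩
    obtain ⟨b, hb⟩ := T.exists_scale_of_point_eq heq
    obtain ⟨j, hj⟩ := R'.2.ne_zero 0
    obtain ⟨e, he, hPP'⟩ := exists_eq_smul_of_cross_mul (P.2.ne_zero 0) (P'.2.ne_zero 0)
      (fun i i' => mul_right_cancel₀ hj (by
        linear_combination P.1 0 i' * hb i j - P.1 0 i * hb i' j))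
    rintro z ⟨P'', R'', rfl, c'', hc'', h''⟩
    refine ⟨P'', R'', rfl, c'' / c' * e * c, ?_, fun i => ?_⟩
    · exact mul_ne_zero (mul_ne_zero (div_ne_zero hc'' hc') he) hc
    · rw [h'', mul_assoc, ← h, mul_assoc, ← hPP', h', div_mul_eq_mul_div, mul_left_comm,
        mul_div_cancel_left₀ _ hc']
  · rintro ⟨v, -, P, c, hc, h⟩ Z hZ
    refine finite_inter_or_subset_of_isClosed_generateFrom ?_ hZ
    rintro U ⟨p, hp, rfl⟩
    exact T.finite_sdiff_basicOpen_or_disjoint hC hq' hCY' hc h hp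

end Dimension

end PointParametrization

end Parametrization

/-! ### Values of words along a sequence of vectors. -/

section Words

variable {k : Type*} [CommSemiring k] {α β : Type*}

/-- The product `c d i₀ * c (d + 1) i₁ * ⋯` of the entries of a sequence of vectors along a word
`[i₀, i₁, …]`. -/
def wordVal (c : ℕ → α → k) : ℕ → List α → k
  | _, [] => 1
  | d, i :: l => c d i * wordVal c (d + 1) l

@[simp]
theorem wordVal_nil (c : ℕ → α → k) (d : ℕ) : wordVal c d [] = 1 := rfl

@[simp]
theorem wordVal_cons (c : ℕ → α → k) (d : ℕ) (i : α) (l : List α) :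
    wordVal c d (i :: l) = c d i * wordVal c (d + 1) l := rfl

theorem wordVal_append (c : ℕ → α → k) (d : ℕ) (l l' : List α) :
    wordVal c d (l ++ l') = wordVal c d l * wordVal c (d + l.length) l' := by
  induction l generalizing d with
  | nil => simp
  | cons i l ih => simp [ih, mul_assoc, add_assoc, add_comm 1]

theorem wordVal_map_range (c : ℕ → α → k) (d n : ℕ) (g : ℕ → α) :
    wordVal c d ((List.range n).map g) = ∏ t ∈ Finset.range n, c (d + t) (g t) := by
  induction n with
  | zero => simp
  | succ n ih => simp [List.range_succ, wordVal_append, ih, Finset.prod_range_succ]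

theorem wordVal_smul (c : ℕ → α → k) (b : ℕ → k) (d : ℕ) (l : List α) :
    wordVal (fun e i => b e * c e i) d l =
      (∏ t ∈ Finset.range l.length, b (d + t)) * wordVal c d l := by
  induction l generalizing d with
  | nil => simp
  | cons i l ih =>
    simp only [wordVal_cons, ih, List.length_cons, Finset.prod_range_succ', add_zero]
    simp only [add_assoc, add_comm 1]
    ring

theorem wordVal_prod (c : ℕ → α → k) (c' : ℕ → β → k) (d : ℕ) (l : List (α × β)) :
    wordVal (fun e i => c e i.1 * c' e i.2) d l =
      wordVal c d (l.map Prod.fst) * wordVal c' d (l.map Prod.snd) := by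
  induction l generalizing d with
  | nil => simp
  | cons i l ih =>
    simp only [wordVal_cons, ih, List.map_cons]
    ring

theorem exists_ne_zero_of_wordVal_ne_zero {c : ℕ → α → k} {d : ℕ} {l : List α}
    (h : wordVal c d l ≠ 0) {t : ℕ} (ht : t < l.length) : ∃ i, c (d + t) i ≠ 0 := by
  induction l generalizing d t with
  | nil => simp at ht
  | cons i l ih =>
    rw [wordVal_cons] at h
    cases t with
    | zero => exact ⟨i, left_ne_zero_of_mul h⟩
    | succ t =>
      obtain ⟨j, hj⟩ := ih (right_ne_zero_of_mul h) (t := t) (by simpa using ht)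
      exact ⟨j, by rwa [add_assoc, add_comm 1] at hj⟩

theorem exists_wordVal_ne_zero [NoZeroDivisors k] [Nontrivial k] {c : ℕ → α → k}
    (h : ∀ d, ∃ i, c d i ≠ 0) (d n : ℕ) : ∃ l : List α, l.length = n ∧ wordVal c d l ≠ 0 := by
  induction n generalizing d with
  | zero => exact ⟨[], rfl, one_ne_zero⟩
  | succ n ih =>
    obtain ⟨i, hi⟩ := h d
    obtain ⟨l, hl, hl0⟩ := ih (d + 1)
    exact ⟨i :: l, by simp [hl], mul_ne_zero hi hl0⟩

theorem map_wordVal {k' : Type*} [CommSemiring k'] (f : k →+* k') (c : ℕ → α → k) (d : ℕ)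
    (l : List α) : f (wordVal c d l) = wordVal (fun e i => f (c e i)) d l := by
  induction l generalizing d with
  | nil => simp
  | cons i l ih => simp [ih]

end Words

/-! ### Words in the quantum polynomial ring and its right modules. -/

namespace QuantumPoly

universe u

variable {k : Type u} [Field k] {n : ℕ} (q : Fin n → Fin n → k)

theorem x_mul_x (i j : Fin n) : x q j * x q i = q j i • (x q i * x q j) := by
  have h := RingQuot.mkAlgHom_rel k (QuantumRel.comm (q := q) i j)
  rw [map_mul, map_smul, map_mul] at h
  exact h

/-- The homomorphism out of the quantum polynomial ring given by elements satisfying the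
relations. -/
def lift {E : Type*} [Semiring E] [Algebra k E] (X : Fin n → E)
    (hX : ∀ i j, X j * X i = q j i • (X i * X j)) : QuantumPoly q →ₐ[k] E :=
  RingQuot.liftAlgHom k ⟨FreeAlgebra.lift k X, by
    rintro _ _ ⟨i, j⟩
    simp [hX i j]⟩

@[simp]
theorem lift_x {E : Type*} [Semiring E] [Algebra k E] (X : Fin n → E)
    (hX : ∀ i j, X j * X i = q j i • (X i * X j)) (i : Fin n) : lift q X hX (x q i) = X i := by
  have h := RingQuot.liftAlgHom_mkAlgHom_apply k (s := QuantumRel q) (FreeAlgebra.lift k X) (by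
    rintro _ _ ⟨i, j⟩
    simp [hX i j]) (FreeAlgebra.ι k i)
  rw [FreeAlgebra.lift_ι_apply] at h
  exact h

/-- The monomial attached to a word in the generators. -/
def word (l : List (Fin n)) : QuantumPoly q := (l.map (x q)).prod

@[simp]
theorem word_nil : word q [] = 1 := rfl

@[simp]
theorem word_cons (i : Fin n) (l : List (Fin n)) : word q (i :: l) = x q i * word q l := by
  simp [word]

theorem word_append (l l' : List (Fin n)) : word q (l ++ l') = word q l * word q l' := by
  simp [word]

theorem deg_eq_span (d : ℕ) : deg q d = Submodule.span k (word q '' {l | l.length = d}) := by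
  induction d with
  | zero =>
    rw [deg, pow_zero, Submodule.one_eq_span]
    congr 1
    ext a
    simp [List.length_eq_zero_iff]
  | succ d ih =>
    rw [deg, pow_succ']
    rw [deg] at ih
    rw [ih, Submodule.span_mul_span]
    congr 1
    ext a
    simp only [Set.mem_mul, Set.mem_range, Set.mem_image, Set.mem_ofPred_eq]
    constructor
    · rintro ⟨_, ⟨i, rfl⟩, _, ⟨l, hl, rfl⟩, rfl⟩
      exact ⟨i :: l, by simp [hl], by simp⟩
    · rintro ⟨l, hl, rfl⟩
      obtain ⟨i, l, rfl⟩ := List.exists_cons_of_length_eq_add_one hl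
      exact ⟨_, ⟨i, rfl⟩, _, ⟨l, by simpa using hl, rfl⟩, by simp⟩

theorem span_range_word : Submodule.span k (Set.range (word q)) = ⊤ := by
  have hmul : ∀ a ∈ Submodule.span k (Set.range (word q)),
      ∀ b ∈ Submodule.span k (Set.range (word q)),
        a * b ∈ Submodule.span k (Set.range (word q)) := by
    intro a ha b hb
    have h := Submodule.mul_mem_mul ha hb
    rw [Submodule.span_mul_span] at h
    refine Submodule.span_mono ?_ h
    rintro _ ⟨_, ⟨l, rfl⟩, _, ⟨l', rfl⟩, rfl⟩
    exact ⟨l ++ l', word_append q l l'⟩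
  rw [eq_top_iff]
  rintro a -
  obtain ⟨b, rfl⟩ := RingQuot.mkAlgHom_surjective k (QuantumRel q) a
  induction b using FreeAlgebra.induction with
  | grade0 r =>
    have h : word q [] ∈ Submodule.span k (Set.range (word q)) := Submodule.subset_span ⟨_, rfl⟩
    rw [AlgHom.commutes, Algebra.algebraMap_eq_smul_one]
    exact Submodule.smul_mem _ r h
  | grade1 i => exact Submodule.subset_span ⟨[i], by rw [word_cons, word_nil, mul_one]; rfl⟩
  | add a b ha hb => rw [map_add]; exact add_mem ha hb
  | mul a b ha hb => rw [map_mul]; exact hmul _ ha _ hb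

theorem fermat_eq_sum_word :
    fermat q = ∑ i, word q ((List.range n).map fun _ => i) := by
  refine Finset.sum_congr rfl fun i _ => ?_
  simp [word]

open MulOpposite

variable {q} {V : Type*} [AddCommGroup V] [Module k V]

/-- Repeated application of the generators along a sequence of vectors in a right module. -/
theorem apply_word {σ : QuantumPoly q →ₐ[k] (Module.End k V)ᵐᵒᵖ} {m : ℕ → V} {P : ℕ → Fin n → k}
    (h : ∀ d i, unop (σ (x q i)) (m d) = P d i • m (d + 1)) (d : ℕ) (l : List (Fin n)) :
    unop (σ (word q l)) (m d) = wordVal P d l • m (d + l.length) := by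
  induction l generalizing d with
  | nil => simp
  | cons i l ih =>
    rw [word_cons, map_mul, unop_mul, Module.End.mul_apply, h, map_smul, ih, smul_smul,
      wordVal_cons, List.length_cons, add_assoc, add_comm 1]

/-- The action of the generators on a sequence of vectors in a right module killed by the Fermat
element is a point sequence. -/
theorem isPointSeq_of_apply {σ : QuantumPoly q →ₐ[k] (Module.End k V)ᵐᵒᵖ} {m : ℕ → V}
    {P : ℕ → Fin n → k} (hm : ∀ d, m d ≠ 0)
    (h : ∀ d i, unop (σ (x q i)) (m d) = P d i • m (d + 1)) (hf : σ (fermat q) = 0)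
    (hne : ∀ d, ∃ l, l.length = d ∧ unop (σ (word q l)) (m 0) ≠ 0) : IsPointSeq q P where
  ne_zero d := by
    obtain ⟨l, hl, hl0⟩ := hne (d + 1)
    rw [apply_word h] at hl0
    simpa using exists_ne_zero_of_wordVal_ne_zero (left_ne_zero_of_smul hl0) (t := d) (by lia)
  comm d i j := by
    have h1 := apply_word h d [j, i]
    have h2 := apply_word h d [i, j]
    simp only [word_cons, word_nil, mul_one, wordVal_cons, wordVal_nil] at h1 h2
    rw [x_mul_x, map_smul, unop_smul, LinearMap.smul_apply, h2, smul_smul] at h1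
    exact (smul_left_injective k (hm _) h1).symm
  fermat d := by
    have h0 : unop (σ (fermat q)) (m d) = 0 := by simp [hf]
    rw [fermat_eq_sum_word, map_sum, Finset.unop_sum,
      LinearMap.sum_apply] at h0
    simp only [apply_word h, List.length_map, List.length_range, wordVal_map_range,
      ← Finset.sum_smul] at h0
    exact (smul_eq_zero.1 h0).resolve_right (hm _)

end QuantumPoly

/-! ### The shift action of the tensor product and its coordinate forms. -/

section TensorAlgebra

universe u

open MulOpposite QuantumPoly

variable {k : Type u} [Field k] {n m : ℕ} (q : Fin n → Fin n → k) (q' : Fin m → Fin m → k)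

/-- The right action of a generator of the first factor on the free vector space on `ℕ × ℕ`. -/
def shiftFst (c : ℕ → k) : Module.End k (ℕ × ℕ →₀ k) :=
  Finsupp.linearCombination k fun d => c d.1 • Finsupp.single (d.1 + 1, d.2) 1

/-- The right action of a generator of the second factor on the free vector space on `ℕ × ℕ`. -/
def shiftSnd (c : ℕ → k) : Module.End k (ℕ × ℕ →₀ k) :=
  Finsupp.linearCombination k fun d => c d.2 • Finsupp.single (d.1, d.2 + 1) 1

theorem shiftFst_single (c : ℕ → k) (a b : ℕ) :
    shiftFst c (Finsupp.single (a, b) 1) = c a • Finsupp.single (a + 1, b) 1 := by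
  simp only [shiftFst, Finsupp.linearCombination_single, one_smul]

theorem shiftSnd_single (c : ℕ → k) (a b : ℕ) :
    shiftSnd c (Finsupp.single (a, b) 1) = c b • Finsupp.single (a, b + 1) 1 := by
  simp only [shiftSnd, Finsupp.linearCombination_single, one_smul]

/-- Endomorphisms of the free vector space on `ℕ × ℕ` are determined by the basis vectors. -/
theorem end_ext {f g : Module.End k (ℕ × ℕ →₀ k)}
    (h : ∀ a b, f (Finsupp.single (a, b) 1) = g (Finsupp.single (a, b) 1)) : f = g :=
  Finsupp.lhom_ext' fun d => LinearMap.ext_ring (h d.1 d.2)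

variable {q q'} {P : ℕ → Fin n → k} {R : ℕ → Fin m → k}

/-- The right action of the first factor attached to a point sequence. -/
def fstAction (hP : IsPointSeq q P) : QuantumPoly q →ₐ[k] (Module.End k (ℕ × ℕ →₀ k))ᵐᵒᵖ :=
  QuantumPoly.lift q (fun i => op (shiftFst fun d => P d i)) fun i j => by
    apply unop_injective
    refine end_ext fun a b => ?_
    simp only [unop_mul, unop_smul, unop_op, Module.End.mul_apply, LinearMap.smul_apply,
      shiftFst_single, map_smul, smul_smul]
    rw [hP.comm]

/-- The right action of the second factor attached to a point sequence. -/
def sndAction (hR : IsPointSeq q' R) : QuantumPoly q' →ₐ[k] (Module.End k (ℕ × ℕ →₀ k))ᵐᵒᵖ :=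
  QuantumPoly.lift q' (fun i => op (shiftSnd fun d => R d i)) fun i j => by
    apply unop_injective
    refine end_ext fun a b => ?_
    simp only [unop_mul, unop_smul, unop_op, Module.End.mul_apply, LinearMap.smul_apply,
      shiftSnd_single, map_smul, smul_smul]
    rw [hR.comm]

theorem fstAction_word (hP : IsPointSeq q P) (l : List (Fin n)) (a b : ℕ) :
    unop (fstAction hP (word q l)) (Finsupp.single (a, b) 1) =
      wordVal P a l • Finsupp.single (a + l.length, b) 1 :=
  apply_word (σ := fstAction hP) (m := fun a => Finsupp.single (a, b) 1)
    (fun d i => by rw [fstAction, lift_x, unop_op, shiftFst_single]) a l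

theorem sndAction_word (hR : IsPointSeq q' R) (l : List (Fin m)) (a b : ℕ) :
    unop (sndAction hR (word q' l)) (Finsupp.single (a, b) 1) =
      wordVal R b l • Finsupp.single (a, b + l.length) 1 :=
  apply_word (σ := sndAction hR) (m := fun b => Finsupp.single (a, b) 1)
    (fun d i => by rw [sndAction, lift_x, unop_op, shiftSnd_single]) b l

/-- The weights of one factor depend only on the index that the other factor leaves fixed. By
linearity it suffices to compare words on basis vectors. -/
theorem commute_fstAction_sndAction (hP : IsPointSeq q P) (hR : IsPointSeq q' R)
    (a : QuantumPoly q) (b : QuantumPoly q') : Commute (fstAction hP a) (sndAction hR b) := by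
  have ha : a ∈ Submodule.span k (Set.range (word q)) := span_range_word q ▸ Submodule.mem_top
  have hb : b ∈ Submodule.span k (Set.range (word q')) := span_range_word q' ▸ Submodule.mem_top
  induction ha using Submodule.span_induction with
  | zero => rw [map_zero]; exact Commute.zero_left _
  | add a a' _ _ h h' => rw [map_add]; exact h.add_left h'
  | smul c a _ h => rw [map_smul]; exact h.smul_left c
  | mem a ha =>
    obtain ⟨l, rfl⟩ := ha
    induction hb using Submodule.span_induction with
    | zero => rw [map_zero]; exact Commute.zero_right _
    | add a a' _ _ h h' => rw [map_add]; exact h.add_right h'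
    | smul c a _ h => rw [map_smul]; exact h.smul_right c
    | mem b hb =>
      obtain ⟨l', rfl⟩ := hb
      apply unop_injective
      refine end_ext fun a b => ?_
      simp only [unop_mul, Module.End.mul_apply, fstAction_word, sndAction_word, map_smul,
        smul_smul]
      rw [mul_comm]

/-- The right action of the tensor product attached to a pair of point sequences. -/
def tensorAction (hP : IsPointSeq q P) (hR : IsPointSeq q' R) :
    QuantumPoly q ⊗[k] QuantumPoly q' →ₐ[k] (Module.End k (ℕ × ℕ →₀ k))ᵐᵒᵖ :=
  Algebra.TensorProduct.lift (fstAction hP) (sndAction hR) (commute_fstAction_sndAction hP hR)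

theorem tensorAction_word (hP : IsPointSeq q P) (hR : IsPointSeq q' R) (l : List (Fin n))
    (l' : List (Fin m)) (a b : ℕ) :
    unop (tensorAction hP hR (word q l ⊗ₜ word q' l')) (Finsupp.single (a, b) 1) =
      (wordVal P a l * wordVal R b l') • Finsupp.single (a + l.length, b + l'.length) 1 := by
  rw [tensorAction, Algebra.TensorProduct.lift_tmul, unop_mul, Module.End.mul_apply,
    fstAction_word, map_smul, sndAction_word, smul_smul]

/-- The kernel is a two-sided ideal, so only the two generators matter. They kill every basis vector
because point sequences satisfy the Fermat equation starting at every degree. -/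
theorem tensorAction_eq_zero (hP : IsPointSeq q P) (hR : IsPointSeq q' R)
    {z : QuantumPoly q ⊗[k] QuantumPoly q'} (hz : z ∈ idealJ q q') :
    tensorAction hP hR z = 0 := by
  have hle : idealJ q q' ≤ TwoSidedIdeal.ker (tensorAction hP hR) := by
    rw [idealJ, TwoSidedIdeal.span_le]
    rintro z (rfl | rfl)
    · rw [SetLike.mem_coe, TwoSidedIdeal.mem_ker]
      apply unop_injective
      refine end_ext fun a b => ?_
      rw [fermat_eq_sum_word, TensorProduct.sum_tmul, map_sum, Finset.unop_sum,
        LinearMap.sum_apply, ← word_nil q']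
      simp only [tensorAction_word, wordVal_map_range, List.length_map, List.length_range,
        wordVal_nil, mul_one, ← Finset.sum_smul, hP.fermat, zero_smul]
      simp
    · rw [SetLike.mem_coe, TwoSidedIdeal.mem_ker]
      apply unop_injective
      refine end_ext fun a b => ?_
      rw [fermat_eq_sum_word, TensorProduct.tmul_sum, map_sum, Finset.unop_sum,
        LinearMap.sum_apply, ← word_nil q]
      simp only [tensorAction_word, wordVal_map_range, List.length_map, List.length_range,
        wordVal_nil, one_mul, ← Finset.sum_smul, hR.fermat, zero_smul]
      simp
  exact (TwoSidedIdeal.mem_ker _).1 (hle hz)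

/-- The right action of `A ⊗ B / J` attached to a pair of point sequences. -/
def tensorQuotAction (hP : IsPointSeq q P) (hR : IsPointSeq q' R) :
    (idealJ q q').ringCon.Quotient →ₐ[k] (Module.End k (ℕ × ℕ →₀ k))ᵐᵒᵖ :=
  RingCon.liftₐ _ (tensorAction hP hR) fun x y h => by
    have h0 := tensorAction_eq_zero hP hR ((TwoSidedIdeal.rel_iff _ _ _).1 h)
    rw [map_sub, sub_eq_zero] at h0
    exact h0

variable (q q') in
/-- The image in `A ⊗ B / J` of a pair of words. -/
def tensorWord (l : List (Fin n)) (l' : List (Fin m)) : (idealJ q q').ringCon.Quotient :=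
  (idealJ q q').ringCon.mkₐ k (word q l ⊗ₜ word q' l')

theorem tensorQuotAction_word (hP : IsPointSeq q P) (hR : IsPointSeq q' R) (l : List (Fin n))
    (l' : List (Fin m)) (a b : ℕ) :
    unop (tensorQuotAction hP hR (tensorWord q q' l l')) (Finsupp.single (a, b) 1) =
      (wordVal P a l * wordVal R b l') • Finsupp.single (a + l.length, b + l'.length) 1 :=
  tensorAction_word hP hR l l' a b

variable (q q')

theorem tensorDeg_eq_span (d : ℕ × ℕ) : tensorDeg (deg q) (deg q') d =
    Submodule.span k ((fun l : List (Fin n) × List (Fin m) => word q l.1 ⊗ₜ[k] word q' l.2) ''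
      {l | l.1.length = d.1 ∧ l.2.length = d.2}) := by
  have h : tensorDeg (deg q) (deg q') d =
      Submodule.map₂ (TensorProduct.mk k _ _) (deg q d.1) (deg q' d.2) := by
    rw [tensorDeg, TensorProduct.range_map, Submodule.range_subtype, Submodule.range_subtype]
  rw [h, deg_eq_span, deg_eq_span, Submodule.map₂_span_span]
  congr 1
  ext z
  simp only [Set.mem_image2, Set.mem_image, Set.mem_ofPred_eq, Prod.exists]
  constructor
  · rintro ⟨_, ⟨l, hl, rfl⟩, _, ⟨l', hl', rfl⟩, rfl⟩
    exact ⟨l, l', ⟨hl, hl'⟩, rfl⟩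
  · rintro ⟨l, l', ⟨hl, hl'⟩, rfl⟩
    exact ⟨_, ⟨l, hl, rfl⟩, _, ⟨l', hl', rfl⟩, rfl⟩

theorem tensorQuotDeg_eq_span (d : ℕ × ℕ) : tensorQuotDeg (deg q) (deg q') (idealJ q q') d =
    Submodule.span k ((fun l : List (Fin n) × List (Fin m) => tensorWord q q' l.1 l.2) ''
      {l | l.1.length = d.1 ∧ l.2.length = d.2}) := by
  rw [tensorQuotDeg, tensorDeg_eq_span, Submodule.map_span, Set.image_image]
  rfl

theorem tensorWord_mem (l : List (Fin n)) (l' : List (Fin m)) :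
    tensorWord q q' l l' ∈
      tensorQuotDeg (deg q) (deg q') (idealJ q q') (l.length, l'.length) := by
  rw [tensorQuotDeg_eq_span]
  exact Submodule.subset_span ⟨(l, l'), ⟨rfl, rfl⟩, rfl⟩

theorem iSup_tensorQuotDeg : ⨆ d, tensorQuotDeg (deg q) (deg q') (idealJ q q') d = ⊤ := by
  rw [eq_top_iff]
  rintro z -
  obtain ⟨z, rfl⟩ := RingCon.mkₐ_surjective (α := k) _ z
  induction z with
  | zero => rw [map_zero]; exact zero_mem _
  | add a b ha hb => rw [map_add]; exact add_mem ha hb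
  | tmul a b =>
    have ha : a ∈ Submodule.span k (Set.range (word q)) := span_range_word q ▸ Submodule.mem_top
    have hb : b ∈ Submodule.span k (Set.range (word q')) := span_range_word q' ▸ Submodule.mem_top
    induction ha using Submodule.span_induction with
    | zero => rw [TensorProduct.zero_tmul, map_zero]; exact zero_mem _
    | add a a' _ _ h h' => rw [TensorProduct.add_tmul, map_add]; exact add_mem h h'
    | smul c a _ h =>
      rw [← TensorProduct.smul_tmul', map_smul]
      exact Submodule.smul_mem _ _ h
    | mem a ha =>
      obtain ⟨l, rfl⟩ := ha
      induction hb using Submodule.span_induction with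
      | zero => rw [TensorProduct.tmul_zero, map_zero]; exact zero_mem _
      | add a a' _ _ h h' => rw [TensorProduct.tmul_add, map_add]; exact add_mem h h'
      | smul c a _ h =>
        rw [TensorProduct.tmul_smul, map_smul]
        exact Submodule.smul_mem _ _ h
      | mem b hb =>
        obtain ⟨l', rfl⟩ := hb
        exact Submodule.mem_iSup_of_mem (l.length, l'.length) (tensorWord_mem q q' l l')

variable {q q'}

theorem eq_of_eq_tensorWord {W : Type*} [AddCommGroup W] [Module k W]
    {f g : (idealJ q q').ringCon.Quotient →ₗ[k] W} {d : ℕ × ℕ}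
    (h : ∀ l l', l.length = d.1 → l'.length = d.2 →
      f (tensorWord q q' l l') = g (tensorWord q q' l l')) {a : (idealJ q q').ringCon.Quotient}
    (ha : a ∈ tensorQuotDeg (deg q) (deg q') (idealJ q q') d) : f a = g a := by
  rw [tensorQuotDeg_eq_span] at ha
  refine LinearMap.eqOn_span ?_ ha
  rintro _ ⟨l, hl, rfl⟩
  exact h l.1 l.2 hl.1 hl.2

/-- The linear form on `A ⊗ B / J` giving the coordinates in degree `d` of the point module
attached to a pair of point sequences. -/
def tensorForm (hP : IsPointSeq q P) (hR : IsPointSeq q' R) (d : ℕ × ℕ) :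
    (idealJ q q').ringCon.Quotient →ₗ[k] k :=
  Finsupp.lapply d ∘ₗ LinearMap.applyₗ (Finsupp.single (0, 0) 1) ∘ₗ
    (opLinearEquiv k).symm.toLinearMap ∘ₗ (tensorQuotAction hP hR).toLinearMap

theorem tensorForm_word (hP : IsPointSeq q P) (hR : IsPointSeq q' R) {d : ℕ × ℕ}
    {l : List (Fin n)} {l' : List (Fin m)} (hl : l.length = d.1) (hl' : l'.length = d.2) :
    tensorForm hP hR d (tensorWord q q' l l') = wordVal P 0 l * wordVal R 0 l' := by
  have h : tensorForm hP hR d (tensorWord q q' l l') =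
      (unop (tensorQuotAction hP hR (tensorWord q q' l l')) (Finsupp.single (0, 0) 1)) d := rfl
  rw [h, tensorQuotAction_word, zero_add, zero_add, hl, hl']
  simp

theorem tensorQuotAction_single (hP : IsPointSeq q P) (hR : IsPointSeq q' R) (d e : ℕ × ℕ)
    {a : (idealJ q q').ringCon.Quotient}
    (ha : a ∈ tensorQuotDeg (deg q) (deg q') (idealJ q q') e) :
    ∃ c : k, unop (tensorQuotAction hP hR a) (Finsupp.single d 1) =
      c • Finsupp.single (d + e) 1 := by
  rw [tensorQuotDeg_eq_span] at ha
  induction ha using Submodule.span_induction with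
  | zero => exact ⟨0, by simp⟩
  | add a b _ _ ha hb =>
    obtain ⟨c, hc⟩ := ha
    obtain ⟨c', hc'⟩ := hb
    exact ⟨c + c', by rw [map_add, unop_add, LinearMap.add_apply, hc, hc', add_smul]⟩
  | smul r a _ ha =>
    obtain ⟨c, hc⟩ := ha
    exact ⟨r * c, by rw [map_smul, unop_smul, LinearMap.smul_apply, hc, smul_smul]⟩
  | mem a ha =>
    obtain ⟨⟨l, l'⟩, ⟨hl, hl'⟩, rfl⟩ := ha
    refine ⟨wordVal P d.1 l * wordVal R d.2 l', (tensorQuotAction_word hP hR l l' d.1 d.2).trans ?_⟩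
    simp only at hl hl'
    rw [hl, hl']
    rfl

theorem tensorQuotAction_single_zero (hP : IsPointSeq q P) (hR : IsPointSeq q' R) (d : ℕ × ℕ)
    {a : (idealJ q q').ringCon.Quotient}
    (ha : a ∈ tensorQuotDeg (deg q) (deg q') (idealJ q q') d) :
    unop (tensorQuotAction hP hR a) (Finsupp.single 0 1) =
      tensorForm hP hR d a • Finsupp.single d 1 := by
  obtain ⟨c, hc⟩ := tensorQuotAction_single hP hR 0 d ha
  rw [zero_add] at hc
  have h : tensorForm hP hR d a =
    (unop (tensorQuotAction hP hR a) (Finsupp.single 0 1)) d := rfl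
  rw [h, hc]
  simp

theorem tensorForm_scale {P' : ℕ → Fin n → k} {R' : ℕ → Fin m → k} (hP : IsPointSeq q P)
    (hR : IsPointSeq q' R) (hP' : IsPointSeq q P') (hR' : IsPointSeq q' R') {c c' : ℕ → k}
    (h : ∀ d i, P' d i = c d * P d i) (h' : ∀ d i, R' d i = c' d * R d i) {d : ℕ × ℕ}
    {a : (idealJ q q').ringCon.Quotient}
    (ha : a ∈ tensorQuotDeg (deg q) (deg q') (idealJ q q') d) :
    tensorForm hP' hR' d a = (∏ t ∈ Finset.range d.1, c t) * (∏ t ∈ Finset.range d.2, c' t) *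
      tensorForm hP hR d a := by
  have := eq_of_eq_tensorWord (f := tensorForm hP' hR' d)
    (g := ((∏ t ∈ Finset.range d.1, c t) * (∏ t ∈ Finset.range d.2, c' t)) • tensorForm hP hR d)
    (fun l l' hl hl' => by
      rw [LinearMap.smul_apply, tensorForm_word _ _ hl hl', tensorForm_word _ _ hl hl',
        show P' = fun d i => c d * P d i from funext fun d => funext (h d),
        show R' = fun d i => c' d * R d i from funext fun d => funext (h' d), wordVal_smul,
        wordVal_smul, hl, hl']
      simp only [zero_add, smul_eq_mul]
      ring) ha
  simpa using this

theorem exists_tensorForm_eq_eval (hP : IsPointSeq q P) (t : Fin m → k) {d : ℕ × ℕ}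
    {a : (idealJ q q').ringCon.Quotient}
    (ha : a ∈ tensorQuotDeg (deg q) (deg q') (idealJ q q') d) :
    ∃ G : MvPolynomial (Fin m) k, ∀ (R : ℕ → Fin m → k) (hR : IsPointSeq q' R) r,
      R = twistedSeq t r → tensorForm hP hR d a = MvPolynomial.eval r G := by
  rw [tensorQuotDeg_eq_span] at ha
  induction ha using Submodule.span_induction with
  | zero => exact ⟨0, by simp⟩
  | add a b _ _ ha hb =>
    obtain ⟨G, hG⟩ := ha
    obtain ⟨G', hG'⟩ := hb
    exact ⟨G + G', fun R hR r h => by rw [map_add, map_add, hG R hR r h, hG' R hR r h]⟩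
  | smul c a _ ha =>
    obtain ⟨G, hG⟩ := ha
    exact ⟨c • G, fun R hR r h => by
      rw [map_smul, hG R hR r h, MvPolynomial.smul_eval, smul_eq_mul]⟩
  | mem a ha =>
    obtain ⟨⟨l, l'⟩, ⟨hl, hl'⟩, rfl⟩ := ha
    refine ⟨MvPolynomial.C (wordVal P 0 l) *
      wordVal (fun d i => MvPolynomial.C (t i ^ d) * MvPolynomial.X i) 0 l', ?_⟩
    rintro R hR r rfl
    rw [tensorForm_word hP hR hl hl', map_mul, map_wordVal (MvPolynomial.eval r),
      MvPolynomial.eval_C]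
    simp only [map_mul, MvPolynomial.eval_C, MvPolynomial.eval_X]
    rfl

end TensorAlgebra

/-! ### The algebra action on a point module. -/

section ToEnd

universe u v w

variable {k : Type u} [Field k] {C : Type v} [Ring C] [Algebra k C]
  {ι : Type w} [AddMonoid ι] [DecidableEq ι] {𝒞 : ι → Submodule k C}

open MulOpposite

/-- The action of the algebra on a point module. -/
def PointModule.toEnd (M : PointModule 𝒞) : C →ₐ[k] (Module.End k M.carrier)ᵐᵒᵖ where
  toFun a := op
    { toFun := fun m => op a • m
      map_add' := smul_add _
      map_smul' := fun c m => M.smul_op_smul c _ m }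
  map_one' := unop_injective (LinearMap.ext fun m => one_smul _ m)
  map_mul' a b := unop_injective (LinearMap.ext fun m => M.op_mul_smul a b m)
  map_zero' := unop_injective (LinearMap.ext fun m => zero_smul _ m)
  map_add' a b := unop_injective (LinearMap.ext fun m => add_smul (op a) (op b) m)
  commutes' c := unop_injective (LinearMap.ext fun m => by
    have h := M.op_smul_smul c 1 m
    rw [← Algebra.algebraMap_eq_smul_one, op_one, one_smul] at h
    exact h)

/-- The linear map `a ↦ m · a`. -/
def PointModule.orbit (M : PointModule 𝒞) (m : M.carrier) : C →ₗ[k] M.carrier :=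
  LinearMap.applyₗ m ∘ₗ (opLinearEquiv k).symm.toLinearMap ∘ₗ M.toEnd.toLinearMap

theorem PointModule.orbit_apply (M : PointModule 𝒞) (a : C) (m : M.carrier) :
    M.orbit m a = op a • m := rfl

end ToEnd

/-! ### Point modules of the tensor quotient as pairs of point sequences. -/

section TensorParametrization

universe u

open MulOpposite QuantumPoly

variable {k : Type u} [Field k] {n m : ℕ} {q : Fin n → Fin n → k} {q' : Fin m → Fin m → k}

theorem exists_tensorPointModule {P : ℕ → Fin n → k} {R : ℕ → Fin m → k} (hP : IsPointSeq q P)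
    (hR : IsPointSeq q' R) :
    ∃ M : PointModule (tensorQuotDeg (deg q) (deg q') (idealJ q q')),
      M.IsCoord fun s => tensorForm hP hR s.1 s.2 := by
  refine exists_pointModule (tensorQuotAction hP hR) (iSup_tensorQuotDeg q q')
    (fun d => Finsupp.single d 1) (Finsupp.linearIndependent_single_one k _) _
    (fun d e a ha => tensorQuotAction_single hP hR d e ha)
    (fun d a => tensorQuotAction_single_zero hP hR d a.2) fun d => ?_
  obtain ⟨l, hl, hl0⟩ := exists_wordVal_ne_zero hP.ne_zero 0 d.1
  obtain ⟨l', hl', hl0'⟩ := exists_wordVal_ne_zero hR.ne_zero 0 d.2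
  refine ⟨⟨tensorWord q q' l l', ?_⟩, ?_⟩
  · have := tensorWord_mem q q' l l'
    rwa [hl, hl'] at this
  · simp only
    rw [tensorForm_word hP hR hl hl']
    exact mul_ne_zero hl0 hl0'

theorem tensorWord_eq_mul (l : List (Fin n)) (l' : List (Fin m)) :
    tensorWord q q' l l' = tensorWord q q' l [] * tensorWord q q' [] l' := by
  rw [tensorWord, tensorWord, tensorWord, ← map_mul, Algebra.TensorProduct.tmul_mul_tmul, word_nil,
    word_nil, mul_one, one_mul]

theorem tensorWord_eq_mul' (l : List (Fin n)) (l' : List (Fin m)) :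
    tensorWord q q' l l' = tensorWord q q' [] l' * tensorWord q q' l [] := by
  rw [tensorWord, tensorWord, tensorWord, ← map_mul, Algebra.TensorProduct.tmul_mul_tmul, word_nil,
    word_nil, mul_one, one_mul]

theorem mkₐ_eq_zero {z : QuantumPoly q ⊗[k] QuantumPoly q'} (hz : z ∈ idealJ q q') :
    (idealJ q q').ringCon.mkₐ k z = 0 := by
  rw [← map_zero ((idealJ q q').ringCon.mkₐ k)]
  exact (RingCon.eq _).2 ((TwoSidedIdeal.mem_iff _ _).1 hz)

theorem exists_tensorForm_isCoord (M : PointModule (tensorQuotDeg (deg q) (deg q') (idealJ q q'))) :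
    ∃ (P : ℕ → Fin n → k) (R : ℕ → Fin m → k) (hP : IsPointSeq q P) (hR : IsPointSeq q' R),
      M.IsCoord fun s => tensorForm hP hR s.1 s.2 := by
  obtain ⟨v, hv⟩ := M.exists_basis
  have hne : ∀ d : ℕ × ℕ, ∃ l l', l.length = d.1 ∧ l'.length = d.2 ∧
      op (tensorWord q q' l l') • v 0 ≠ 0 := by
    intro d
    by_contra! hcon
    obtain ⟨a, ha, ha0⟩ :=
      M.exists_op_smul_ne_zero (iSup_tensorQuotDeg q q') (hv 0).1 (hv 0).2 d
    exact ha0 (eq_of_eq_tensorWord (f := M.orbit (v 0)) (g := 0) (fun l l' hl hl' =>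
      hcon l l' hl hl') ha)
  let σ : QuantumPoly q →ₐ[k] (Module.End k M.carrier)ᵐᵒᵖ :=
    (M.toEnd.comp ((idealJ q q').ringCon.mkₐ k)).comp Algebra.TensorProduct.includeLeft
  let τ : QuantumPoly q' →ₐ[k] (Module.End k M.carrier)ᵐᵒᵖ :=
    (M.toEnd.comp ((idealJ q q').ringCon.mkₐ k)).comp Algebra.TensorProduct.includeRight
  have hσ : ∀ l x, unop (σ (word q l)) x = op (tensorWord q q' l []) • x := fun _ _ => rfl
  have hτ : ∀ l x, unop (τ (word q' l)) x = op (tensorWord q q' [] l) • x := fun _ _ => rfl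
  have hP : ∀ a i, ∃ c : k, unop (σ (x q i)) (v (a, 0)) = c • v (a + 1, 0) := fun a i => by
    refine M.exists_smul_eq (hv _).1 (hv _).2 ?_
    have h := M.smul_mem (hv (a, 0)).1 (tensorWord_mem q q' [i] [])
    rwa [← hσ, word_cons, word_nil, mul_one] at h
  have hR : ∀ b i, ∃ c : k, unop (τ (x q' i)) (v (0, b)) = c • v (0, b + 1) := fun b i => by
    refine M.exists_smul_eq (hv _).1 (hv _).2 ?_
    have h := M.smul_mem (hv (0, b)).1 (tensorWord_mem q q' [] [i])
    rwa [← hτ, word_cons, word_nil, mul_one] at h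
  choose P hP using hP
  choose R hR using hR
  have hPseq : IsPointSeq q P := by
    refine isPointSeq_of_apply (σ := σ) (m := fun a => v (a, 0)) (fun d => (hv _).2) hP ?_ ?_
    · simp only [σ, AlgHom.comp_apply, Algebra.TensorProduct.includeLeft_apply]
      rw [mkₐ_eq_zero (TwoSidedIdeal.subset_span (by simp)), map_zero]
    · intro d
      obtain ⟨l, l', hl, hl', h⟩ := hne (d, 0)
      obtain rfl := List.length_eq_zero_iff.1 hl'
      exact ⟨l, hl, h⟩
  have hRseq : IsPointSeq q' R := by
    refine isPointSeq_of_apply (σ := τ) (m := fun b => v (0, b)) (fun d => (hv _).2) hR ?_ ?_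
    · simp only [τ, AlgHom.comp_apply, Algebra.TensorProduct.includeRight_apply]
      rw [mkₐ_eq_zero (TwoSidedIdeal.subset_span (by simp)), map_zero]
    · intro d
      obtain ⟨l, l', hl, hl', h⟩ := hne (0, d)
      obtain rfl := List.length_eq_zero_iff.1 hl
      exact ⟨l', hl', h⟩
  have hPw := apply_word (σ := σ) (m := fun a => v (a, 0)) hP 0
  have hRw := apply_word (σ := τ) (m := fun b => v (0, b)) hR 0
  simp only [hσ, hτ, zero_add] at hPw hRw
  choose w hw hw0 using exists_wordVal_ne_zero hPseq.ne_zero 0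
  -- `P` and `R` are read off along the two axes. The bases off the axes are unrelated, so they are
  -- replaced by the translates of `v (0, b)` under a word of nonzero value, divided by that value.
  let v' : ℕ × ℕ → M.carrier := fun d =>
    (wordVal P 0 (w d.1))⁻¹ • op (tensorWord q q' (w d.1) []) • v (0, d.2)
  have hv'0 : v' 0 = v 0 := by
    have h : w 0 = [] := List.length_eq_zero_iff.1 (hw 0)
    simp only [v', Prod.fst_zero, Prod.snd_zero, h, wordVal_nil, inv_one, one_smul]
    rw [hPw []]
    simp only [wordVal_nil, one_smul]
    rfl
  have hword : ∀ l l', op (tensorWord q q' l l') • v 0 =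
      (wordVal P 0 l * wordVal R 0 l') • v' (l.length, l'.length) := by
    intro l l'
    -- Write `v (l.length, 0)` as a normalized translate of `v 0` and commute the two factors: this
    -- moves the word in the `y_j` onto the axis where `R` is known.
    have h1 : op (tensorWord q q' [] l') • v (l.length, 0) =
        wordVal R 0 l' • v' (l.length, l'.length) := by
      have h2 : v (l.length, 0) = (wordVal P 0 (w l.length))⁻¹ •
          op (tensorWord q q' (w l.length) []) • v 0 := by
        have := hPw (w l.length)
        rw [hw] at this
        rw [show (0 : ℕ × ℕ) = (0, 0) from rfl, this, smul_smul, inv_mul_cancel₀ (hw0 _), one_smul]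
      rw [h2, M.smul_op_smul, ← M.op_mul_smul, ← tensorWord_eq_mul, tensorWord_eq_mul',
        M.op_mul_smul, show (0 : ℕ × ℕ) = (0, 0) from rfl, hRw, M.smul_op_smul, smul_comm]
    rw [tensorWord_eq_mul, M.op_mul_smul, show (0 : ℕ × ℕ) = (0, 0) from rfl, hPw, M.smul_op_smul,
      h1, smul_smul]
  refine ⟨P, R, hPseq, hRseq, v', fun d => ⟨?_, ?_⟩, fun d a => ?_⟩
  · refine Submodule.smul_mem _ _ ?_
    have h := M.smul_mem (hv (0, d.2)).1 (tensorWord_mem q q' (w d.1) [])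
    rw [hw] at h
    simpa using h
  · intro h0
    obtain ⟨l, l', hl, hl', h⟩ := hne d
    rw [hword, hl, hl', h0, smul_zero] at h
    exact h rfl
  · rw [hv'0]
    exact eq_of_eq_tensorWord (f := M.orbit (v 0))
      (g := (tensorForm hPseq hRseq d).smulRight (v' d)) (fun l l' hl hl' => by
        rw [M.orbit_apply, hword, LinearMap.smulRight_apply, tensorForm_word _ _ hl hl', hl, hl'])
      a.2

/-- The parametrization of the point modules of `A ⊗ B / J`. -/
def tensorParametrization (q : Fin n → Fin n → k) (q' : Fin m → Fin m → k) :
    PointParametrization q q' (tensorQuotDeg (deg q) (deg q') (idealJ q q')) where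
  coord P R s := tensorForm P.2 R.2 s.1 s.2
  exists_isCoord P R := exists_tensorPointModule P.2 R.2
  isCoord M := by
    obtain ⟨P, R, hP, hR, h⟩ := exists_tensorForm_isCoord M
    exact ⟨⟨P, hP⟩, ⟨R, hR⟩, h⟩
  scale P P' R R' c c' hc hc' h h' :=
    ⟨fun d => (∏ t ∈ Finset.range d.1, c t) * ∏ t ∈ Finset.range d.2, c' t,
      fun _ => mul_ne_zero (Finset.prod_ne_zero_iff.2 fun t _ => hc t)
        (Finset.prod_ne_zero_iff.2 fun t _ => hc' t), by simp,
      fun s => tensorForm_scale P.2 R.2 P'.2 R'.2 h h' s.2.2⟩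
  elem := ⟨(1, 1), fun i j => ⟨tensorWord q q' [i] [j], tensorWord_mem q q' [i] [j]⟩,
    fun P R i j => by
      simp only
      rw [tensorForm_word P.2 R.2 rfl rfl]
      simp⟩
  poly P t s := by
    obtain ⟨G, hG⟩ := exists_tensorForm_eq_eval (q' := q') P.2 t s.2.2
    exact ⟨G, fun R r h => hG R.1 R.2 r h⟩

end TensorParametrization

/-! ### Point modules of the Segre quotient as pairs of point sequences. -/

section SegreParametrization

universe u

open MulOpposite QuantumPoly

variable {k : Type u} [Field k] {n m : ℕ} (q : Fin n → Fin n → k) (q' : Fin m → Fin m → k)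

theorem tensorDeg_le_segreProduct (i : ℕ) : tensorDeg (deg q) (deg q') (i, i) ≤
    (segreProduct (deg q) (deg q')).toSubmodule :=
  le_iSup (fun i : ℕ => tensorDeg (deg q) (deg q') (i, i)) i

/-- The generator `x i ⊗ y j` of the Segre product. -/
def segreGen (i : Fin n × Fin m) : segreProduct (deg q) (deg q') :=
  ⟨x q i.1 ⊗ₜ x q' i.2, tensorDeg_le_segreProduct q q' 1 (by
    rw [tensorDeg_eq_span]
    exact Submodule.subset_span ⟨([i.1], [i.2]), ⟨rfl, rfl⟩, by simp⟩)⟩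

/-- The monomial of the Segre product attached to a word of pairs. -/
def segreMonomial (l : List (Fin n × Fin m)) : segreProduct (deg q) (deg q') :=
  (l.map (segreGen q q')).prod

theorem coe_segreMonomial (l : List (Fin n × Fin m)) :
    (segreMonomial q q' l : QuantumPoly q ⊗[k] QuantumPoly q') =
      word q (l.map Prod.fst) ⊗ₜ word q' (l.map Prod.snd) := by
  induction l with
  | nil => rfl
  | cons i l ih =>
    have h : segreMonomial q q' (i :: l) = segreGen q q' i * segreMonomial q q' l := by
      simp [segreMonomial]
    rw [h, MulMemClass.coe_mul, ih, List.map_cons, List.map_cons, word_cons, word_cons,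
      ← Algebra.TensorProduct.tmul_mul_tmul]
    rfl

/-- The image of a monomial in `A ∘ B / J_Δ`. -/
def segreWord (l : List (Fin n × Fin m)) :
    (diagIdeal (deg q) (deg q') (idealJ q q')).ringCon.Quotient :=
  (diagIdeal (deg q) (deg q') (idealJ q q')).ringCon.mkₐ k (segreMonomial q q' l)

@[simp]
theorem segreWord_nil : segreWord q q' [] = 1 := rfl

theorem segreWord_cons (i : Fin n × Fin m) (l : List (Fin n × Fin m)) :
    segreWord q q' (i :: l) = segreWord q q' [i] * segreWord q q' l := by
  simp [segreWord, segreMonomial]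

theorem segreQuotDeg_eq_span (d : ℕ) : segreQuotDeg (deg q) (deg q') (idealJ q q') d =
    Submodule.span k (segreWord q q' '' {l | l.length = d}) := by
  have h : (tensorDeg (deg q) (deg q') (d, d)).comap
      (segreProduct (deg q) (deg q')).val.toLinearMap =
      Submodule.span k (segreMonomial q q' '' {l | l.length = d}) := by
    have hinj : Function.Injective (segreProduct (deg q) (deg q')).val.toLinearMap :=
      Subtype.val_injective
    rw [← Submodule.comap_map_eq_of_injective hinj (Submodule.span k _), Submodule.map_span,
      tensorDeg_eq_span, Set.image_image]
    congr 2
    ext z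
    simp only [Set.mem_image, Set.mem_ofPred_eq, Prod.exists]
    constructor
    · rintro ⟨l, l', ⟨hl, hl'⟩, rfl⟩
      -- Two words of equal length zip to a word of pairs, so the Segre product is generated by the
      -- elements `x i ⊗ y j`.
      refine ⟨l.zip l', by simp [hl, hl'], (coe_segreMonomial q q' _).trans ?_⟩
      rw [List.map_fst_zip (by lia), List.map_snd_zip (by lia)]
    · rintro ⟨l, hl, rfl⟩
      exact ⟨_, _, ⟨by simpa using hl, by simpa using hl⟩, (coe_segreMonomial q q' l).symm⟩
  rw [segreQuotDeg, h, Submodule.map_span, Set.image_image]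
  rfl

theorem segreWord_mem (l : List (Fin n × Fin m)) :
    segreWord q q' l ∈ segreQuotDeg (deg q) (deg q') (idealJ q q') l.length := by
  rw [segreQuotDeg_eq_span]
  exact Submodule.subset_span ⟨l, rfl, rfl⟩

theorem iSup_segreQuotDeg : ⨆ d, segreQuotDeg (deg q) (deg q') (idealJ q q') d = ⊤ := by
  have h : ⨆ d : ℕ, (tensorDeg (deg q) (deg q') (d, d)).comap
      (segreProduct (deg q) (deg q')).val.toLinearMap = ⊤ := by
    rw [eq_top_iff]
    rintro ⟨z, hz⟩ -
    have hz' : z ∈ ⨆ d : ℕ, tensorDeg (deg q) (deg q') (d, d) := hz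
    have hmem : ∀ y (hy : y ∈ ⨆ d : ℕ, tensorDeg (deg q) (deg q') (d, d)),
        (⟨y, hy⟩ : segreProduct (deg q) (deg q')) ∈
        ⨆ d : ℕ, (tensorDeg (deg q) (deg q') (d, d)).comap
          (segreProduct (deg q) (deg q')).val.toLinearMap := by
      intro y hy
      induction hy using Submodule.iSup_induction' with
      | zero => exact zero_mem _
      | add a b _ _ ha hb => exact add_mem ha hb
      | mem i a ha => exact Submodule.mem_iSup_of_mem i ha
    exact hmem z hz'
  simp only [segreQuotDeg]
  rw [← Submodule.map_iSup, h, Submodule.map_top, LinearMap.range_eq_top]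
  exact RingCon.mkₐ_surjective (α := k) _

variable {q q'}

theorem eq_of_eq_segreWord {W : Type*} [AddCommGroup W] [Module k W]
    {f g : (diagIdeal (deg q) (deg q') (idealJ q q')).ringCon.Quotient →ₗ[k] W} {d : ℕ}
    (h : ∀ l, l.length = d → f (segreWord q q' l) = g (segreWord q q' l))
    {a : (diagIdeal (deg q) (deg q') (idealJ q q')).ringCon.Quotient}
    (ha : a ∈ segreQuotDeg (deg q) (deg q') (idealJ q q') d) : f a = g a := by
  rw [segreQuotDeg_eq_span] at ha
  refine LinearMap.eqOn_span ?_ ha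
  rintro _ ⟨l, hl, rfl⟩
  exact h l hl

variable (q q') in
/-- The homomorphism `A ∘ B / J_Δ → A ⊗ B / J` induced by the inclusion. -/
def segreToTensor : (diagIdeal (deg q) (deg q') (idealJ q q')).ringCon.Quotient →ₐ[k]
    (idealJ q q').ringCon.Quotient :=
  RingCon.liftₐ _ (((idealJ q q').ringCon.mkₐ k).comp (segreProduct (deg q) (deg q')).val)
    fun _ _ h => (RingCon.eq _).2 h

theorem segreToTensor_word (l : List (Fin n × Fin m)) :
    segreToTensor q q' (segreWord q q' l) =
      tensorWord q q' (l.map Prod.fst) (l.map Prod.snd) :=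
  congrArg ((idealJ q q').ringCon.mkₐ k) (coe_segreMonomial q q' l)

theorem segreToTensor_mem {d : ℕ}
    {a : (diagIdeal (deg q) (deg q') (idealJ q q')).ringCon.Quotient}
    (ha : a ∈ segreQuotDeg (deg q) (deg q') (idealJ q q') d) :
    segreToTensor q q' a ∈ tensorQuotDeg (deg q) (deg q') (idealJ q q') (d, d) := by
  obtain ⟨z, hz, rfl⟩ := ha
  exact ⟨z, hz, rfl⟩

variable {P : ℕ → Fin n → k} {R : ℕ → Fin m → k}

/-- The linear form on `A ∘ B / J_Δ` giving the coordinates in degree `d` of the point module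
attached to a pair of point sequences. -/
def segreForm (hP : IsPointSeq q P) (hR : IsPointSeq q' R) (d : ℕ) :
    (diagIdeal (deg q) (deg q') (idealJ q q')).ringCon.Quotient →ₗ[k] k :=
  tensorForm hP hR (d, d) ∘ₗ (segreToTensor q q').toLinearMap

theorem segreForm_word (hP : IsPointSeq q P) (hR : IsPointSeq q' R) {d : ℕ}
    {l : List (Fin n × Fin m)} (hl : l.length = d) :
    segreForm hP hR d (segreWord q q' l) =
      wordVal P 0 (l.map Prod.fst) * wordVal R 0 (l.map Prod.snd) := by
  rw [segreForm, LinearMap.comp_apply, AlgHom.toLinearMap_apply, segreToTensor_word]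
  exact tensorForm_word hP hR (by simpa using hl) (by simpa using hl)

theorem exists_segrePointModule (hP : IsPointSeq q P) (hR : IsPointSeq q' R) :
    ∃ M : PointModule (segreQuotDeg (deg q) (deg q') (idealJ q q')),
      M.IsCoord fun s => segreForm hP hR s.1 s.2 := by
  refine exists_pointModule ((tensorQuotAction hP hR).comp (segreToTensor q q'))
    (iSup_segreQuotDeg q q') (fun d => Finsupp.single (d, d) 1)
    ((Finsupp.linearIndependent_single_one k _).comp (fun d : ℕ => (d, d))
      fun a b h => congrArg Prod.fst h) _
    (fun d e a ha => tensorQuotAction_single hP hR (d, d) (e, e) (segreToTensor_mem ha))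
    (fun d a => tensorQuotAction_single_zero hP hR (d, d) (segreToTensor_mem a.2)) fun d => ?_
  obtain ⟨l, hl, hl0⟩ := exists_wordVal_ne_zero hP.ne_zero 0 d
  obtain ⟨l', hl', hl0'⟩ := exists_wordVal_ne_zero hR.ne_zero 0 d
  refine ⟨⟨segreWord q q' (l.zip l'), ?_⟩, ?_⟩
  · have := segreWord_mem q q' (l.zip l')
    rwa [List.length_zip, hl, hl', min_self] at this
  · simp only
    rw [segreForm_word hP hR (by simp [hl, hl']), List.map_fst_zip (by lia),
      List.map_snd_zip (by lia)]
    exact mul_ne_zero hl0 hl0'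

/-- The two first entries can be exchanged while the second entries stay in place. This is the
relation that forces the structure constants to have rank one. -/
theorem segreWord_swap_fst (i j : Fin n) (a b : Fin m) :
    segreWord q q' [(j, a), (i, b)] = q j i • segreWord q q' [(i, a), (j, b)] := by
  rw [segreWord, segreWord, ← map_smul]
  congr 1
  apply Subtype.ext
  rw [Subalgebra.coe_smul, coe_segreMonomial, coe_segreMonomial, TensorProduct.smul_tmul']
  simp only [List.map_cons, List.map_nil, word_cons, word_nil, mul_one]
  rw [x_mul_x]

theorem segreWord_swap_snd (i j : Fin m) (a b : Fin n) :
    segreWord q q' [(a, j), (b, i)] = q' j i • segreWord q q' [(a, i), (b, j)] := by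
  rw [segreWord, segreWord, ← map_smul]
  congr 1
  apply Subtype.ext
  rw [Subalgebra.coe_smul, coe_segreMonomial, coe_segreMonomial, ← TensorProduct.tmul_smul]
  simp only [List.map_cons, List.map_nil, word_cons, word_nil, mul_one]
  rw [x_mul_x q']

theorem diag_mkₐ_eq_zero {z : segreProduct (deg q) (deg q')}
    (hz : (z : QuantumPoly q ⊗[k] QuantumPoly q') ∈ idealJ q q') :
    (diagIdeal (deg q) (deg q') (idealJ q q')).ringCon.mkₐ k z = 0 := by
  rw [← map_zero ((diagIdeal (deg q) (deg q') (idealJ q q')).ringCon.mkₐ k)]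
  exact (RingCon.eq _).2 ((TwoSidedIdeal.mem_iff _ _).1 ((TwoSidedIdeal.mem_comap _).2 hz))

/-- The element `f ⊗ 1` is not of diagonal degree; multiplied by a word of length `n` in the second
factor it lies in `J_Δ`. -/
theorem sum_segreWord_fst (g : ℕ → Fin m) :
    ∑ i, segreWord q q' ((List.range n).map fun t => (i, g t)) = 0 := by
  simp only [segreWord]
  rw [← map_sum]
  apply diag_mkₐ_eq_zero
  rw [AddSubmonoidClass.coe_finsetSum]
  simp only [coe_segreMonomial, List.map_map, Function.comp_def]
  rw [← TensorProduct.sum_tmul, ← fermat_eq_sum_word]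
  have h := (idealJ q q').mul_mem_right _ (1 ⊗ₜ word q' ((List.range n).map g))
    (TwoSidedIdeal.subset_span (s := {fermat q ⊗ₜ[k] (1 : QuantumPoly q'), 1 ⊗ₜ[k] fermat q'})
      (Or.inl rfl))
  rwa [Algebra.TensorProduct.tmul_mul_tmul, one_mul, mul_one] at h

theorem sum_segreWord_snd (g : ℕ → Fin n) :
    ∑ i, segreWord q q' ((List.range m).map fun t => (g t, i)) = 0 := by
  simp only [segreWord]
  rw [← map_sum]
  apply diag_mkₐ_eq_zero
  rw [AddSubmonoidClass.coe_finsetSum]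
  simp only [coe_segreMonomial, List.map_map, Function.comp_def]
  rw [← TensorProduct.tmul_sum, ← fermat_eq_sum_word]
  have h := (idealJ q q').mul_mem_left (word q ((List.range m).map g) ⊗ₜ 1) _
    (TwoSidedIdeal.subset_span (s := {fermat q ⊗ₜ[k] (1 : QuantumPoly q'), 1 ⊗ₜ[k] fermat q'})
      (Or.inr rfl))
  rwa [Algebra.TensorProduct.tmul_mul_tmul, one_mul, mul_one] at h

/-- Structure constants satisfying the relations of `A ∘ B / J_Δ` are products of two point
sequences. -/
theorem exists_isPointSeq_mul_eq {c : ℕ → Fin n × Fin m → k} (hne : ∀ d, ∃ i, c d i ≠ 0)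
    (hfst : ∀ d i j a b, c d (j, a) * c (d + 1) (i, b) =
      q j i * (c d (i, a) * c (d + 1) (j, b)))
    (hsnd : ∀ d i j a b, c d (a, j) * c (d + 1) (b, i) =
      q' j i * (c d (a, i) * c (d + 1) (b, j)))
    (hsumfst : ∀ d (g : ℕ → Fin m), ∑ i, ∏ t ∈ Finset.range n, c (d + t) (i, g t) = 0)
    (hsumsnd : ∀ d (g : ℕ → Fin n), ∑ i, ∏ t ∈ Finset.range m, c (d + t) (g t, i) = 0) :
    ∃ (P : ℕ → Fin n → k) (R : ℕ → Fin m → k), IsPointSeq q P ∧ IsPointSeq q' R ∧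
      ∀ d i, c d i = P d i.1 * R d i.2 := by
  -- Fix a nonzero entry `(s, t)` of `c (d + 1)`. The commutation rule then writes `c d (i, j)` as a
  -- factor depending on `i` times `c d (s, j)`.
  have hrank : ∀ d, ∃ (P : Fin n → k) (R : Fin m → k), ∀ i, c d i = P i.1 * R i.2 := by
    intro d
    obtain ⟨⟨s, t⟩, hst⟩ := hne (d + 1)
    refine ⟨fun i => q i s * c (d + 1) (i, t) / c (d + 1) (s, t), fun j => c d (s, j), ?_⟩
    rintro ⟨i, j⟩
    have h := hfst d s i j t
    rw [div_mul_eq_mul_div, eq_div_iff hst, h]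
    ring
  choose P R hPR using hrank
  have hP0 : ∀ d, ∃ i, P d i ≠ 0 := fun d => by
    obtain ⟨i, hi⟩ := hne d
    rw [hPR] at hi
    exact ⟨i.1, left_ne_zero_of_mul hi⟩
  have hR0 : ∀ d, ∃ i, R d i ≠ 0 := fun d => by
    obtain ⟨i, hi⟩ := hne d
    rw [hPR] at hi
    exact ⟨i.2, right_ne_zero_of_mul hi⟩
  have hP : IsPointSeq q P := by
    refine ⟨hP0, fun d i j => ?_, fun d => ?_⟩
    · obtain ⟨a, ha⟩ := hR0 d
      obtain ⟨b, hb⟩ := hR0 (d + 1)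
      have h := hfst d i j a b
      simp only [hPR] at h
      apply mul_right_cancel₀ (mul_ne_zero ha hb)
      linear_combination h
    -- Choosing the second indices with nonzero entries of `R` lets the common factor be cancelled,
    -- leaving the Fermat equation for `P`.
    · choose g hg using hR0
      have h := hsumfst d fun t => g (d + t)
      simp only [hPR, Finset.prod_mul_distrib, ← Finset.sum_mul] at h
      exact (mul_eq_zero.1 h).resolve_right (Finset.prod_ne_zero_iff.2 fun t _ => hg _)
  have hR : IsPointSeq q' R := by
    refine ⟨hR0, fun d i j => ?_, fun d => ?_⟩
    · obtain ⟨a, ha⟩ := hP0 d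
      obtain ⟨b, hb⟩ := hP0 (d + 1)
      have h := hsnd d i j a b
      simp only [hPR] at h
      apply mul_right_cancel₀ (mul_ne_zero ha hb)
      linear_combination h
    · choose g hg using hP0
      have h := hsumsnd d fun t => g (d + t)
      simp only [hPR, Finset.prod_mul_distrib, ← Finset.mul_sum] at h
      exact (mul_eq_zero.1 h).resolve_left (Finset.prod_ne_zero_iff.2 fun t _ => hg _)
  exact ⟨P, R, hP, hR, hPR⟩

set_option maxHeartbeats 400000 in
theorem exists_segreForm_isCoord (M : PointModule (segreQuotDeg (deg q) (deg q') (idealJ q q'))) :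
    ∃ (P : ℕ → Fin n → k) (R : ℕ → Fin m → k) (hP : IsPointSeq q P) (hR : IsPointSeq q' R),
      M.IsCoord fun s => segreForm hP hR s.1 s.2 := by
  obtain ⟨v, hv⟩ := M.exists_basis
  have hc : ∀ d i, ∃ c : k, op (segreWord q q' [i]) • v d = c • v (d + 1) := fun d i =>
    M.exists_smul_eq (hv _).1 (hv _).2 (M.smul_mem (hv d).1 (segreWord_mem q q' [i]))
  choose c hc using hc
  have hword : ∀ d l, op (segreWord q q' l) • v d = wordVal c d l • v (d + l.length) := by
    intro d l
    induction l generalizing d with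
    | nil => simp
    | cons i l ih =>
      rw [segreWord_cons, M.op_mul_smul, hc, M.smul_op_smul, ih, smul_smul, wordVal_cons,
        List.length_cons, add_assoc, add_comm 1]
  have hne : ∀ d, ∃ i, c d i ≠ 0 := by
    intro d
    by_contra! hcon
    obtain ⟨a, ha, ha0⟩ :=
      M.exists_op_smul_ne_zero (iSup_segreQuotDeg q q') (hv 0).1 (hv 0).2 (d + 1)
    refine ha0 (eq_of_eq_segreWord (f := M.orbit (v 0)) (g := 0) (fun l hl => ?_) ha)
    rw [M.orbit_apply, hword, LinearMap.zero_apply]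
    by_contra h0
    obtain ⟨i, hi⟩ := exists_ne_zero_of_wordVal_ne_zero (left_ne_zero_of_smul h0) (t := d) (by lia)
    exact hi (by rw [zero_add, hcon])
  have hfst : ∀ d i j a b, c d (j, a) * c (d + 1) (i, b) =
      q j i * (c d (i, a) * c (d + 1) (j, b)) := by
    intro d i j a b
    have h := congrArg (fun z => op z • v d) (segreWord_swap_fst (q := q) (q' := q') i j a b)
    simp only [M.op_smul_smul, hword, smul_smul, wordVal_cons, wordVal_nil, mul_one,
      List.length_cons, List.length_nil] at h
    exact smul_left_injective k (hv _).2 h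
  have hsnd : ∀ d i j a b, c d (a, j) * c (d + 1) (b, i) =
      q' j i * (c d (a, i) * c (d + 1) (b, j)) := by
    intro d i j a b
    have h := congrArg (fun z => op z • v d) (segreWord_swap_snd (q := q) (q' := q') i j a b)
    simp only [M.op_smul_smul, hword, smul_smul, wordVal_cons, wordVal_nil, mul_one,
      List.length_cons, List.length_nil] at h
    exact smul_left_injective k (hv _).2 h
  have hsumfst : ∀ d (g : ℕ → Fin m), ∑ i, ∏ t ∈ Finset.range n, c (d + t) (i, g t) = 0 := by
    intro d g
    have h := congrArg (M.orbit (v d)) (sum_segreWord_fst (q := q) (q' := q') g)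
    rw [map_sum, map_zero] at h
    simp only [M.orbit_apply, hword, wordVal_map_range, List.length_map, List.length_range,
      ← Finset.sum_smul] at h
    exact (smul_eq_zero.1 h).resolve_right (hv _).2
  have hsumsnd : ∀ d (g : ℕ → Fin n), ∑ i, ∏ t ∈ Finset.range m, c (d + t) (g t, i) = 0 := by
    intro d g
    have h := congrArg (M.orbit (v d)) (sum_segreWord_snd (q := q) (q' := q') g)
    rw [map_sum, map_zero] at h
    simp only [M.orbit_apply, hword, wordVal_map_range, List.length_map, List.length_range,
      ← Finset.sum_smul] at h
    exact (smul_eq_zero.1 h).resolve_right (hv _).2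
  obtain ⟨P, R, hP, hR, hPR⟩ := exists_isPointSeq_mul_eq hne hfst hsnd hsumfst hsumsnd
  have hcfun : c = fun e i => P e i.1 * R e i.2 := funext fun d => funext (hPR d)
  refine ⟨P, R, hP, hR, v, hv, fun d a => ?_⟩
  have hl : ∀ l, l.length = d → M.orbit (v 0) (segreWord q q' l) =
      (segreForm hP hR d).smulRight (v d) (segreWord q q' l) := by
    rintro l rfl
    have h := hword 0 l
    rw [hcfun, wordVal_prod, zero_add, ← segreForm_word hP hR rfl] at h
    exact h
  exact eq_of_eq_segreWord hl a.2

/-- The parametrization of the point modules of `A ∘ B / J_Δ`. -/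
def segreParametrization (q : Fin n → Fin n → k) (q' : Fin m → Fin m → k) :
    PointParametrization q q' (segreQuotDeg (deg q) (deg q') (idealJ q q')) where
  coord P R s := segreForm P.2 R.2 s.1 s.2
  exists_isCoord P R := exists_segrePointModule P.2 R.2
  isCoord M := by
    obtain ⟨P, R, hP, hR, h⟩ := exists_segreForm_isCoord M
    exact ⟨⟨P, hP⟩, ⟨R, hR⟩, h⟩
  scale P P' R R' c c' hc hc' h h' :=
    ⟨fun d => (∏ t ∈ Finset.range d, c t) * ∏ t ∈ Finset.range d, c' t,
      fun _ => mul_ne_zero (Finset.prod_ne_zero_iff.2 fun t _ => hc t)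
        (Finset.prod_ne_zero_iff.2 fun t _ => hc' t), by simp,
      fun s => tensorForm_scale P.2 R.2 P'.2 R'.2 h h' (segreToTensor_mem s.2.2)⟩
  elem := ⟨1, fun i j => ⟨segreWord q q' [(i, j)], segreWord_mem q q' [(i, j)]⟩,
    fun P R i j => by
      simp only
      rw [segreForm_word P.2 R.2 (d := 1) rfl]
      simp⟩
  poly P t s := by
    obtain ⟨G, hG⟩ := exists_tensorForm_eq_eval (q' := q') P.2 t (segreToTensor_mem s.2.2)
    exact ⟨G, fun R r h => hG R.1 R.2 r h⟩

end SegreParametrization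

theorem proposition4p2 {k : Type*} [Field k] [IsAlgClosed k] [CharZero k]
    (q : Fin 4 → Fin 4 → k) (q' : Fin 3 → Fin 3 → k)
    (hq : IsQuantumParameter q) (hq' : IsQuantumParameter q')
    (hCY : IsCalabiYauParameter q) (hCY' : IsCalabiYauParameter q')
    (hgen : IsGeneralParameter q) :
    topologicalKrullDim (TensorPointModuli q q') = 1 ∧
      topologicalKrullDim (SegrePointModuli q q') = 1 :=
  ⟨(tensorParametrization q q').topologicalKrullDim_eq_one (iSup_tensorQuotDeg q q') hq hq' hCY
      hCY' hgen,
    (segreParametrization q q').topologicalKrullDim_eq_one (iSup_segreQuotDeg q q') hq hq' hCY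
      hCY' hgen⟩
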